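/- All graphs are finite and simple. A graph $G$ has a $K_3$-decomposition if its edge set can be partitioned into (edge sets of) triangles; it is $K_3$-divisible if its number of edges is divisible by $3$ and all its vertex degrees are even. Write $\delta(G)$ and $\Delta(G)$ for the minimum and maximum degree of $G$. Let $\delta^{0+}$ (the approximate triangle-decomposition threshold) be the infimum of all $\delta\in[0,1]$ with the following property: for all $\gamma>0$ there exists $n_0\in\mathbb{N}$ such that every graph $G$ on $n\ge n_0$ vertices with $\delta(G)\ge\delta n$ contains a $K_3$-decomposable subgraph $H$ with $\Delta(G-H)\le\gamma n$, where $G-H$ has vertex set $V(G)$ and edge set $E(G)\setminus E(H)$. For $n\in\mathbb{N}$ let $\delta(n)$ be the least $d\in\mathbb{N}$ such that every $K_3$-divisible graph $G$ on $n$ vertices with $\delta(G)\ge d$ has a $K_3$-decomposition, and let $\delta_{K_3}:=\limsup_{n\to\infty}\delta(n)/n$. **Theorem 1.2.** Let $\delta:=\max\{3/4,\delta^{0+}\}$. For every $\varepsilon>0$ there exists $n_0\in\mathbb{N}$ such that every $K_3$-divisible graph $G$ on $n\ge n_0$ vertices with $\delta(G)\ge(\delta+\varepsilon)n$ has a $K_3$-decomposition.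 Equivalently, $\delta_{K_3}\le\max\{3/4,\delta^{0+}\}$. -/

import Mathlib

/-- `G` has a `K₃`-decomposition: its edge set can be partitioned into triangles. Triangles are given
by their vertex sets (the `3`-cliques of `G`), and every edge of `G` lies in exactly one of them. -/
def HasTriangleDecomposition {V : Type*} (G : SimpleGraph V) : Prop :=
  ∃ T : Set (Finset V), (∀ t ∈ T, G.IsNClique 3 t) ∧
    ∀ u v : V, G.Adj u v → ∃! t : Finset V, t ∈ T ∧ u ∈ t ∧ v ∈ t

/-- `G` is `K₃`-divisible: the number of edges is divisible by `3` and all degrees are even. -/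
def IsTriangleDivisible {V : Type*} [Fintype V] [DecidableEq V] (G : SimpleGraph V)
    [DecidableRel G.Adj] : Prop :=
  3 ∣ G.edgeFinset.card ∧ ∀ v : V, Even (G.degree v)

open Classical in
/-- The property in the definition of the approximate decomposition threshold: for all `γ > 0`,
every graph `G` on sufficiently many vertices `n` with minimum degree at least `δ n` has a
`K₃`-decomposable subgraph `H` such that the leftover `G - H` (same vertices, edge set
`E(G) \ E(H)`) has maximum degree at most `γ n`. -/
def ApproxDecompositionProperty (δ : ℝ) : Prop :=
  ∀ γ : ℝ, 0 < γ → ∃ n₀ : ℕ, ∀ n : ℕ, n₀ ≤ n → ∀ G : SimpleGraph (Fin n),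
    δ * (n : ℝ) ≤ (G.minDegree : ℝ) →
      ∃ H : SimpleGraph (Fin n), H ≤ G ∧ HasTriangleDecomposition H ∧
        ((G \ H).maxDegree : ℝ) ≤ γ * (n : ℝ)

/-- The approximate decomposition threshold `δ^{0+}` of `K₃`. The set is bounded below by `0`, and
it contains `1` because no graph on `n ≥ 1` vertices has minimum degree at least `n`. -/
noncomputable def approxDecompositionThreshold : ℝ :=
  sInf {δ : ℝ | δ ∈ Set.Icc (0 : ℝ) 1 ∧ ApproxDecompositionProperty δ}

open Classical in
/-- `δ(n)`: the least natural number `d` such that every `K₃`-divisible graph on `n` vertices with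
minimum degree at least `d` has a `K₃`-decomposition. Every `d ≥ n` has this property. -/
noncomputable def minDegreeForDecomposition (n : ℕ) : ℕ :=
  sInf {d : ℕ | ∀ G : SimpleGraph (Fin n), IsTriangleDivisible G → d ≤ G.minDegree →
    HasTriangleDecomposition G}

/-- The decomposition threshold of `K₃`, the upper limit of `δ(n) / n`. This sequence takes values
in `[0, 1]`. -/
noncomputable def decompositionThreshold : ℝ :=
  Filter.limsup (fun n : ℕ => (minDegreeForDecomposition n : ℝ) / (n : ℝ)) Filter.atTop

/-!
The proof sets aside absorbers for all possible small leftovers, decomposes everything else along a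
vortex, and then absorbs what is left.

A *vortex* is a sequence of vertex sets `V = U₀ ⊇ U₁ ⊇ … ⊇ W`, each a small constant proportion of
the one before, down to a set `W` of bounded size, such that relative degrees into each set are about
as large as in the whole graph (`exists_isVortex`); random subsets do this, and
`exists_balanced_colouring` provides them. One step along a vortex covers all edges not inside `U'`
by edge-disjoint triangles of the graph on `U`, using only few edges inside `U'` (`exists_cover`).
The edges inside the next set `U''` are kept for later, so the degree conditions survive every step,
and all that remains at the end is a graph `L` on `W` (`exists_cover_of_isVortex`). This graph `L` is
triangle-divisible, since the whole graph is and decomposable graphs are.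

As `W` has bounded size, there are boundedly many possibilities for `L`. Before the covering steps, an
*absorber* is reserved for each of them: a graph `A` with no edges inside `W` such that both `A` and
`A ∪ L` are decomposable (`exists_absorber_family`). The absorber is explicit, and its vertices can
be ordered so that each has at most four earlier neighbours. Four vertices have many common
neighbours when the minimum degree exceeds `3n/4`, so it embeds greedily; this is
where `3/4` is needed. The absorber of the actual leftover absorbs it, and the other absorbers
are decomposed on their own.

For the covering step (`exists_cover_of_plane`), vertices are labelled at random by the points and by
the lines of a projective plane of large order. The edges from `x ∉ U` to those `u ∈ U` whose point
lies on the line of `x` are reserved. The approximate decomposition property is applied to the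
remaining edges not inside `U`. Its leftover has small maximum degree, and it is covered greedily by
triangles with two edges that are reserved or inside `U` (`exists_greedy_cover`); here it matters
that any two lines meet. The ends in `U` of the unused reserved edges at `x ∉ U` form a set `N x` of
even size, and a perfect matching of `N x` completes these edges to triangles. It exists by Dirac's
condition, since any two vertices have well over half of the neighbourhood of either in common.
The matchings of different `x` can be made edge-disjoint
because two distinct points lie on only one common line (`exists_disjoint_matchings`), so that only
the few `x` with the same line compete for an edge.
-/

section

open Classical Finset

/-- The number of neighbours of `x` in the finite set `S`. -/
noncomputable def degIn {V : Type*} (G : SimpleGraph V) (x : V) (S : Finset V) : ℕ :=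
  (S.filter (G.Adj x)).card

/-! ### Triangle decompositions and degrees into a set -/

section Decomposition

variable {V W : Type*}

theorem hasTriangleDecomposition_bot : HasTriangleDecomposition (⊥ : SimpleGraph V) :=
  ⟨∅, by simp, by simp⟩

theorem HasTriangleDecomposition.sup {G H : SimpleGraph V} (hG : HasTriangleDecomposition G)
    (hH : HasTriangleDecomposition H) (hd : ∀ x y, G.Adj x y → ¬ H.Adj x y) :
    HasTriangleDecomposition (G ⊔ H) := by
  obtain ⟨T, hT, hTu⟩ := hG
  obtain ⟨S, hS, hSu⟩ := hH
  refine ⟨T ∪ S, ?_, ?_⟩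
  · rintro t (ht | ht)
    · exact (hT t ht).mono le_sup_left
    · exact (hS t ht).mono le_sup_right
  · rintro u v (huv | huv)
    · obtain ⟨t, ⟨ht, hu, hv⟩, hun⟩ := hTu u v huv
      refine ⟨t, ⟨Or.inl ht, hu, hv⟩, ?_⟩
      rintro t' ⟨ht' | ht', hu', hv'⟩
      · exact hun t' ⟨ht', hu', hv'⟩
      · exact absurd ((hS t' ht').1 hu' hv' huv.ne) (hd _ _ huv)
    · obtain ⟨t, ⟨ht, hu, hv⟩, hun⟩ := hSu u v huv
      refine ⟨t, ⟨Or.inr ht, hu, hv⟩, ?_⟩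
      rintro t' ⟨ht' | ht', hu', hv'⟩
      · exact absurd huv (hd _ _ ((hT t' ht').1 hu' hv' huv.ne))
      · exact hun t' ⟨ht', hu', hv'⟩

theorem HasTriangleDecomposition.map {G : SimpleGraph V} (hG : HasTriangleDecomposition G)
    (f : V ↪ W) : HasTriangleDecomposition (G.map f) := by
  obtain ⟨T, hT, hTu⟩ := hG
  refine ⟨(fun t => t.map f) '' T, ?_, ?_⟩
  · rintro _ ⟨t, ht, rfl⟩
    exact (hT t ht).map
  · rintro _ _ ⟨-, u, v, huv, rfl, rfl⟩
    obtain ⟨t, ⟨ht, hu, hv⟩, hun⟩ := hTu u v huv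
    refine ⟨t.map f, ⟨⟨t, ht, rfl⟩, by simpa using hu, by simpa using hv⟩, ?_⟩
    rintro _ ⟨⟨s, hs, rfl⟩, hu', hv'⟩
    rw [hun s ⟨hs, by simpa using hu', by simpa using hv'⟩]

/-- A triangle decomposition given by the function sending an edge `xy` to the third vertex
`t x y` of its triangle. -/
theorem hasTriangleDecomposition_of_third {G : SimpleGraph V} (t : V → V → V)
    (hsymm : ∀ x y, G.Adj x y → t x y = t y x)
    (hadj : ∀ x y, G.Adj x y → G.Adj x (t x y))
    (hinv : ∀ x y, G.Adj x y → t x (t x y) = y) : HasTriangleDecomposition G := by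
  refine ⟨{s | ∃ x y, G.Adj x y ∧ s = {x, y, t x y}}, ?_, ?_⟩
  · rintro _ ⟨x, y, h, rfl⟩
    rw [SimpleGraph.is3Clique_triple_iff]
    refine ⟨h, hadj _ _ h, ?_⟩
    rw [hsymm _ _ h]
    exact hadj _ _ h.symm
  · intro u v huv
    refine ⟨{u, v, t u v}, ⟨⟨u, v, huv, rfl⟩, by simp, by simp⟩, ?_⟩
    rintro _ ⟨⟨x, y, h, rfl⟩, hu, hv⟩
    have h1 := hsymm _ _ h
    have h2 := hinv _ _ h
    have h3 := hinv _ _ h.symm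
    have h4 := hsymm _ _ (hadj _ _ h)
    have h5 := hsymm _ _ (hadj _ _ h.symm)
    rw [← h1] at h3 h5
    have huv' := huv.ne
    simp only [Finset.mem_insert, Finset.mem_singleton] at hu hv
    rcases hu with rfl | rfl | rfl <;> rcases hv with rfl | rfl | rfl <;>
      first
      | exact absurd rfl huv'
      | (ext w; grind)

theorem SimpleGraph.degIn_sup_of_disjoint {G H : SimpleGraph V}
    (hd : ∀ x y, G.Adj x y → ¬ H.Adj x y) (x : V) (S : Finset V) :
    degIn (G ⊔ H) x S = degIn G x S + degIn H x S := by
  unfold degIn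
  rw [← Finset.card_union_of_disjoint, ← Finset.filter_or]
  · congr 1
    ext y
    simp
  · rw [Finset.disjoint_filter]
    exact fun y _ h => hd x y h

theorem degIn_mono {G H : SimpleGraph V} (h : G ≤ H) (x : V) {S T : Finset V} (hST : S ⊆ T) :
    degIn G x S ≤ degIn H x T := by
  refine Finset.card_le_card fun y hy => ?_
  simp only [Finset.mem_filter] at hy ⊢
  exact ⟨hST hy.1, h hy.2⟩

variable [Fintype V]

theorem degree_eq_degIn (G : SimpleGraph V) [DecidableRel G.Adj] (x : V) :
    G.degree x = degIn G x univ := by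
  rw [← SimpleGraph.card_neighborFinset_eq_degree, degIn]
  congr 1
  ext y
  simp

/-- A triangle-decomposable graph has even degrees, and its number of edges is a multiple of
three: the degree of `v` is twice the number of triangles at `v`. -/
theorem HasTriangleDecomposition.divisible {G : SimpleGraph V}
    (hG : HasTriangleDecomposition G) :
    (∀ v, Even (degIn G v univ)) ∧ 3 ∣ G.edgeSet.ncard := by
  obtain ⟨T, hT, hTu⟩ := hG
  set F : Finset (Finset V) := univ.filter (· ∈ T) with hF
  have hdeg : ∀ v, degIn G v univ = 2 * (F.filter (v ∈ ·)).card := by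
    intro v
    have h1 : univ.filter (G.Adj v) = (F.filter (v ∈ ·)).biUnion (fun t => t.erase v) := by
      ext u
      simp only [Finset.mem_filter, Finset.mem_univ, true_and, Finset.mem_biUnion,
        Finset.mem_erase, hF]
      constructor
      · intro h
        obtain ⟨t, ⟨ht, hv, hu⟩, -⟩ := hTu _ _ h
        exact ⟨t, ⟨ht, hv⟩, h.ne', hu⟩
      · rintro ⟨t, ⟨ht, hv⟩, hne, hu⟩
        exact (hT t ht).1 hv hu hne.symm
    rw [degIn, h1, Finset.card_biUnion, Finset.sum_congr rfl (g := fun _ => 2)]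
    · simp [mul_comm]
    · intro t ht
      simp only [Finset.mem_filter, Finset.mem_univ, true_and, hF] at ht
      rw [Finset.card_erase_of_mem ht.2, (hT t ht.1).2]
    · intro s hs t ht hst
      simp only [Finset.coe_filter, Finset.mem_filter, Finset.mem_univ, true_and, hF,
        Set.mem_ofPred_eq] at hs ht
      rw [Function.onFun, Finset.disjoint_left]
      intro u hu hu'
      simp only [Finset.mem_erase] at hu hu'
      have hadj : G.Adj v u := (hT s hs.1).1 hs.2 hu.2 hu.1.symm
      exact hst ((hTu _ _ hadj).unique ⟨hs.1, hs.2, hu.2⟩ ⟨ht.1, ht.2, hu'.2⟩)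
  refine ⟨fun v => by rw [hdeg]; exact even_two_mul _, ?_⟩
  have h2 := G.sum_degrees_eq_twice_card_edges
  have h3 : ∑ v, (F.filter (v ∈ ·)).card = 3 * F.card := by
    have := Finset.sum_card_bipartiteAbove_eq_sum_card_bipartiteBelow
      (s := (univ : Finset V)) (t := F) (fun v t => v ∈ t)
    simp only [Finset.bipartiteAbove, Finset.bipartiteBelow] at this
    rw [this, Finset.sum_congr rfl (g := fun _ => 3)]
    · simp [mul_comm]
    · intro t ht
      simp only [Finset.mem_filter, Finset.mem_univ, true_and, hF] at ht
      rw [← (hT t ht).2]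
      congr 1
      ext
      simp
  rw [Finset.sum_congr rfl (fun v _ => (degree_eq_degIn G v).trans (hdeg v)), ← Finset.mul_sum,
    h3] at h2
  refine ⟨F.card, ?_⟩
  rw [← SimpleGraph.coe_edgeFinset, Set.ncard_coe_finset]
  omega

theorem ncard_edgeSet_sup_of_disjoint {G H : SimpleGraph V}
    (hd : ∀ x y, G.Adj x y → ¬ H.Adj x y) :
    (G ⊔ H).edgeSet.ncard = G.edgeSet.ncard + H.edgeSet.ncard := by
  rw [SimpleGraph.edgeSet_sup, Set.ncard_union_eq _ (Set.toFinite _) (Set.toFinite _)]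
  rw [Set.disjoint_left]
  intro e
  induction e with
  | _ x y => exact hd x y

end Decomposition

/-! ### Perfect matchings under Dirac's condition -/

section Dirac

variable {V : Type*} [Fintype V]

/-- Dirac's condition for perfect matchings, the matching being encoded as an involution: if `S`
is even and every vertex of `S` has at least `|S|/2` neighbours in `S`, then the graph induced on
`S` has a perfect matching. -/
theorem exists_perfectMatching {Γ : SimpleGraph V} {S : Finset V} (hS : Even S.card)
    (hdeg : ∀ u ∈ S, S.card ≤ 2 * degIn Γ u S) :
    ∃ m : V → V, ∀ u ∈ S, m u ∈ S ∧ m (m u) = u ∧ Γ.Adj u (m u) := by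
  let P : (V → V) → Prop := fun m => (∀ u, m (m u) = u) ∧ ∀ u, m u ≠ u → u ∈ S ∧ Γ.Adj u (m u)
  -- a matching covering as many vertices as possible
  obtain ⟨m, hm, hmax⟩ := Finset.exists_max_image (univ.filter P)
    (fun m => (univ.filter (fun u => m u ≠ u)).card) ⟨id, by simp [P]⟩
  simp only [Finset.mem_filter, Finset.mem_univ, true_and] at hm hmax
  obtain ⟨hinv, hadj⟩ := hm
  by_cases hall : ∀ u ∈ S, m u ≠ u
  · refine ⟨m, fun u hu => ⟨?_, hinv u, (hadj u (hall u hu)).2⟩⟩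
    refine (hadj (m u) ?_).1
    rw [hinv]
    exact (hall u hu).symm
  push Not at hall
  obtain ⟨u, huS, hu⟩ := hall
  set M : Finset V := univ.filter (fun u => m u ≠ u) with hM
  have hMS : M ⊆ S := fun x hx => (hadj x (by simpa [hM] using hx)).1
  have hMinv : ∀ x ∈ M, m x ∈ M := by
    intro x hx
    simp only [hM, Finset.mem_filter, Finset.mem_univ, true_and] at hx ⊢
    rw [hinv]
    exact hx.symm
  have hMeven : Even M.card := by
    have h0 : ∑ _x ∈ M, (1 : ZMod 2) = 0 :=
      Finset.sum_involution (fun x _ => m x) (fun _ _ => by decide)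
        (fun x hx _ => by simpa [hM] using hx) hMinv (fun x _ => hinv x)
    rw [← ZMod.natCast_eq_zero_iff_even]
    simpa using h0
  have huM : u ∈ S \ M := by simp [hM, hu, huS]
  have hcard : (S \ M).card + M.card = S.card := Finset.card_sdiff_add_card_eq_card hMS
  have hpos : 0 < (S \ M).card := Finset.card_pos.2 ⟨u, huM⟩
  have h1 : 1 < (S \ M).card := by
    obtain ⟨a, ha⟩ := hS
    obtain ⟨b, hb⟩ := hMeven
    omega
  obtain ⟨v, hvM, hvu⟩ := Finset.exists_mem_ne h1 u
  have hfix : ∀ x ∈ S \ M, m x = x := by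
    intro x hx
    simpa [hM, (Finset.mem_sdiff.1 hx).1] using hx
  -- two uncovered vertices are not adjacent
  have hno : ∀ x ∈ S \ M, ∀ y ∈ S \ M, ¬ Γ.Adj x y := by
    intro x hx y hy hxy
    have hxf := hfix x hx
    have hyf := hfix y hy
    have hne := hxy.ne
    have hsymm := hxy.symm
    have := hmax (fun z => if z = x then y else if z = y then x else m z) ⟨by grind, by grind⟩
    refine absurd this (not_le.2 (Finset.card_lt_card ?_))
    rw [Finset.ssubset_iff_of_subset (by intro z; grind)]
    exact ⟨x, by grind, by grind⟩
  have hsub : ∀ x ∈ S \ M, S.filter (Γ.Adj x) ⊆ M := by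
    intro x hx y hy
    rw [Finset.mem_filter] at hy
    by_contra hyM
    exact hno x hx y (Finset.mem_sdiff.2 ⟨hy.1, hyM⟩) hy.2
  have hminj : Function.Injective m := Function.LeftInverse.injective hinv
  have hinter : ((S.filter (Γ.Adj u)) ∩ (S.filter (Γ.Adj v)).image m).Nonempty := by
    refine Finset.inter_nonempty_of_card_lt_card_add_card (hsub u huM)
      (Finset.image_subset_iff.2 fun x hx => hMinv x (hsub v hvM hx)) ?_
    rw [Finset.card_image_of_injective _ hminj]
    have h2 := hdeg u huS
    have h3 := hdeg v (Finset.mem_sdiff.1 hvM).1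
    unfold degIn at h2 h3
    omega
  obtain ⟨y, hy⟩ := hinter
  simp only [Finset.mem_inter, Finset.mem_filter, Finset.mem_image] at hy
  obtain ⟨⟨hyS, huy⟩, y', ⟨hy'S, hvy'⟩, rfl⟩ := hy
  -- rematch `u` with `m y'` and `v` with `y'`
  have hvS := (Finset.mem_sdiff.1 hvM).1
  have huf := hfix u huM
  have hvf := hfix v hvM
  have hy'M : y' ∈ M := hsub v hvM (by simp [hy'S, hvy'])
  have hy'ne : m y' ≠ y' := by simpa [hM] using hy'M
  have huy' := huy.symm
  have hvy'' := hvy'.symm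
  have hi := hinv y'
  have hne1 := huy.ne
  have hne2 := hvy'.ne
  have := hmax (fun z => if z = u then m y' else if z = m y' then u else if z = v then y' else
    if z = y' then v else m z) ⟨by grind, by grind⟩
  refine absurd this (not_le.2 (Finset.card_lt_card ?_))
  rw [Finset.ssubset_iff_of_subset (by intro z; grind)]
  exact ⟨u, by grind, by grind⟩

end Dirac

end

section

open Classical Finset

/-! ### Greedy embeddings -/

section Embedding

/-- Greedy embedding. The relation `E x y` says that the new vertex `x` has to be joined to `y`.
Every new vertex has at most four neighbours among the roots and the vertices of at most its own
rank, so embedding the new vertices by increasing rank needs only common neighbours of four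
vertices of the host graph `G`. -/
theorem exists_embedding_of_degenerate {V X : Type*} [Fintype V] [Fintype X]
    (G : SimpleGraph V) (B : Finset V) (E : X → X → Prop) (root : X → Prop) (rank : X → ℕ)
    (hE : ∀ x y, E x y → root y ∨ rank y < rank x ∨ E y x) (hirr : ∀ x, ¬ E x x)
    (hdeg : ∀ x, ¬ root x → ∃ Q : Finset X, Q.card ≤ 4 ∧ ∀ y, E x y → y ∈ Q)
    (hG : ∀ Q : Finset V, Q.card ≤ 4 →
      B.card + Fintype.card X < (univ.filter fun v => ∀ q ∈ Q, G.Adj v q).card)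
    (φ₀ : X → V) (hinj : Set.InjOn φ₀ {x | root x}) :
    ∃ φ : X → V, Function.Injective φ ∧ (∀ x, root x → φ x = φ₀ x) ∧
      (∀ x, ¬ root x → φ x ∉ B) ∧ ∀ x y, ¬ root x → E x y → G.Adj (φ x) (φ y) := by
  have key : ∀ s : Finset X, (∀ x ∈ s, ¬ root x) →
      ∃ φ : X → V, Set.InjOn φ {x | root x ∨ x ∈ s} ∧ (∀ x, root x → φ x = φ₀ x) ∧
      (∀ x ∈ s, φ x ∉ B) ∧ ∀ x ∈ s, ∀ y, (root y ∨ y ∈ s) → E x y → G.Adj (φ x) (φ y) := by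
    intro s
    induction s using Finset.induction_on_max_value rank with
    | empty => exact fun _ => ⟨φ₀, by simpa using hinj, by simp⟩
    | insert a s has hmax ih =>
      intro hs
      obtain ⟨φ, h1, h2, h3, h4⟩ := ih fun x hx => hs x (Finset.mem_insert_of_mem hx)
      have hra := hs a (Finset.mem_insert_self _ _)
      obtain ⟨Q, hQ, hQE⟩ := hdeg a hra
      obtain ⟨v, hv, hvn⟩ : ∃ v ∈ univ.filter fun v => ∀ q ∈ Q.image φ, G.Adj v q,
          v ∉ B ∪ univ.image φ := by
        refine Finset.exists_mem_notMem_of_card_lt_card ?_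
        refine lt_of_le_of_lt ?_ (hG _ (Finset.card_image_le.trans hQ))
        exact (Finset.card_union_le _ _).trans (Nat.add_le_add_left Finset.card_image_le _)
      simp only [Finset.mem_filter, Finset.mem_univ, true_and, Finset.forall_mem_image] at hv
      simp only [Finset.mem_union, not_or, Finset.mem_image, Finset.mem_univ, true_and,
        not_exists] at hvn
      refine ⟨Function.update φ a v, ?_, ?_, ?_, ?_⟩
      · intro x hx y hy hxy
        simp only [Finset.mem_insert, Set.mem_ofPred_eq] at hx hy
        by_cases hxa : x = a <;> by_cases hya : y = a
        · rw [hxa, hya]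
        · subst hxa
          rw [Function.update_self, Function.update_of_ne hya] at hxy
          exact absurd hxy.symm (hvn.2 y)
        · subst hya
          rw [Function.update_self, Function.update_of_ne hxa] at hxy
          exact absurd hxy (hvn.2 x)
        · rw [Function.update_of_ne hxa, Function.update_of_ne hya] at hxy
          exact h1 (by simpa [hxa] using hx) (by simpa [hya] using hy) hxy
      · intro x hx
        rw [Function.update_of_ne (by rintro rfl; exact hra hx)]
        exact h2 x hx
      · intro x hx
        by_cases hxa : x = a
        · subst hxa
          rw [Function.update_self]
          exact hvn.1
        · rw [Function.update_of_ne hxa]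
          exact h3 x ((Finset.mem_insert.1 hx).resolve_left hxa)
      · intro x hx y hy hxy
        by_cases hxa : x = a <;> by_cases hya : y = a
        · subst hxa; subst hya
          exact absurd hxy (hirr _)
        · subst hxa
          rw [Function.update_self, Function.update_of_ne hya]
          exact hv (hQE y hxy)
        · subst hya
          rw [Function.update_self, Function.update_of_ne hxa]
          have hxs := (Finset.mem_insert.1 hx).resolve_left hxa
          rcases hE x y hxy with h | h | h
          · exact absurd h hra
          · exact absurd h (not_lt.2 (hmax x hxs))
          · exact (hv (hQE x h)).symm
        · rw [Function.update_of_ne hxa, Function.update_of_ne hya]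
          exact h4 x ((Finset.mem_insert.1 hx).resolve_left hxa) y
            (hy.imp_right fun h => (Finset.mem_insert.1 h).resolve_left hya) hxy
  obtain ⟨φ, h1, h2, h3, h4⟩ := key (univ.filter fun x => ¬ root x) (by simp)
  refine ⟨φ, ?_, h2, fun x hx => h3 x (by simpa using hx), fun x y hx hxy =>
    h4 x (by simpa using hx) y (by simpa using Classical.em _) hxy⟩
  intro x y hxy
  exact h1 (by simpa using Classical.em _) (by simpa using Classical.em _) hxy

end Embedding

/-! ### Absorbers -/

section Absorber

set_option linter.unusedSimpArgs false

/-- The vertices of the absorber of a graph `L` on `R`. A half-edge of `L` is a pair `(r, e)` of an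
edge `e` and an end `r` of it. Besides the roots `R` there are a centre `c`, two vertices `a e`,
`b e` and one vertex `w e` for each edge, and vertices `z r e`, `y r e`, `u r e` for each
half-edge. Indices that are not edges or half-edges of `L` give isolated vertices. -/
inductive AbsorberVertex (R : Type*)
  | root (r : R)
  | c
  | a (e : Sym2 R)
  | b (e : Sym2 R)
  | z (r : R) (e : Sym2 R)
  | y (r : R) (e : Sym2 R)
  | w (e : Sym2 R)
  | u (r : R) (e : Sym2 R)

namespace AbsorberVertex

variable {R : Type*}

instance [Finite R] : Finite (AbsorberVertex R) := by
  let f : AbsorberVertex R → Fin 8 × Option R × Option (Sym2 R) := fun x => match x with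
    | root r => (0, some r, none)
    | c => (1, none, none)
    | a e => (2, none, some e)
    | b e => (3, none, some e)
    | z r e => (4, some r, some e)
    | y r e => (5, some r, some e)
    | w e => (6, none, some e)
    | u r e => (7, some r, some e)
  refine Finite.of_injective f ?_
  intro x y h
  cases x <;> cases y <;> simp [f] at h ⊢ <;> exact h

/-- One of the two ends of an edge. -/
noncomputable def lo (e : Sym2 R) : R := (Quot.out e).1

/-- The end of an edge other than `lo`. -/
noncomputable def hi (e : Sym2 R) : R := (Quot.out e).2

theorem lo_hi (e : Sym2 R) : s(lo e, hi e) = e := Quot.out_eq e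

/-- The end of `e` other than `r`. -/
noncomputable def oth (r : R) (e : Sym2 R) : R := if r = lo e then hi e else lo e

/-- The order in which the vertices of an absorber are embedded. -/
def rank : AbsorberVertex R → ℕ
  | root _ => 0
  | c => 0
  | a _ => 1
  | b _ => 2
  | z _ _ => 3
  | y _ _ => 4
  | w _ => 5
  | u _ _ => 6

variable (L : SimpleGraph R) (σ : R → Sym2 R → Sym2 R) (ρ : Sym2 R → Sym2 R)

/-- The edges of the absorber of `L`, directed from the vertex that is embedded later; an edge
between vertices of the same rank is directed both ways. The map `σ r` pairs up the edges of `L`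
at `r`, and `ρ` arranges the edges of `L` in cyclically ordered triples. -/
def Back : AbsorberVertex R → AbsorberVertex R → Prop
  | a e, c => e ∈ L.edgeSet
  | a e, a e' => e ∈ L.edgeSet ∧ (e' = ρ e ∨ e' = ρ (ρ e))
  | b e, c => e ∈ L.edgeSet
  | b e, a e' => e ∈ L.edgeSet ∧ e' = ρ e
  | z r e, root r' => e ∈ L.edgeSet ∧ r ∈ e ∧ r' = r
  | z r e, c => e ∈ L.edgeSet ∧ r ∈ e
  | z r e, a e' => e ∈ L.edgeSet ∧ r ∈ e ∧ e' = e ∧ r ≠ lo e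
  | z r e, b e' => e ∈ L.edgeSet ∧ r ∈ e ∧ e' = e ∧ r = lo e
  | z r e, z r' e' => e ∈ L.edgeSet ∧ r ∈ e ∧ r' = r ∧ e' = σ r e
  | y r e, a e' => e ∈ L.edgeSet ∧ r ∈ e ∧ (e' = e ∧ r ≠ lo e ∨ e' = ρ e)
  | y r e, b e' => e ∈ L.edgeSet ∧ r ∈ e ∧ e' = e ∧ r = lo e
  | y r e, z r' e' => e ∈ L.edgeSet ∧ r ∈ e ∧ r' = r ∧ e' = e
  | y r e, y r' e' => e ∈ L.edgeSet ∧ r ∈ e ∧ r' = oth r e ∧ e' = e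
  | w e, root r' => e ∈ L.edgeSet ∧ r' ∈ e
  | w e, y r' e' => e ∈ L.edgeSet ∧ r' ∈ e ∧ e' = e
  | u r e, root r' => e ∈ L.edgeSet ∧ r ∈ e ∧ r' = r
  | u r e, w e' => e ∈ L.edgeSet ∧ r ∈ e ∧ e' = e
  | u r e, z r' e' => e ∈ L.edgeSet ∧ r ∈ e ∧ r' = r ∧ e' = e
  | u r e, y r' e' => e ∈ L.edgeSet ∧ r ∈ e ∧ r' = r ∧ e' = e
  | _, _ => False

/-- The absorber of `L`. -/
def absorber : SimpleGraph (AbsorberVertex R) :=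
  SimpleGraph.fromRel (Back L σ ρ)

/-- The third vertices of the triangles decomposing the absorber itself. The value on pairs of
vertices that are not adjacent does not matter. -/
noncomputable def thirdWithout : AbsorberVertex R → AbsorberVertex R → AbsorberVertex R
  | root r, w e | w e, root r => u r e
  | root _, u _ e | u _ e, root _ => w e
  | w _, u r _ | u r _, w _ => root r
  | c, a e | a e, c => z (hi e) e
  | c, b e | b e, c => z (lo e) e
  | c, z r e | z r e, c => if r = lo e then b e else a e
  | a _, z _ _ | z _ _, a _ => c
  | b _, z _ _ | z _ _, b _ => c
  | a _, b e | b e, a _ => y (lo e) e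
  | a e, a e' => if e' = ρ e then y (hi e) e else y (hi e') e'
  | a e', y r e | y r e, a e' => if e' = ρ e then (if r = lo e then b e else a e) else a (ρ e)
  | b _, y _ e | y _ e, b _ => a (ρ e)
  | u _ _, z r e | z r e, u _ _ => y r e
  | u _ _, y r e | y r e, u _ _ => z r e
  | y _ _, z r e | z r e, y _ _ => u r e
  | root _, z r e | z r e, root _ => z r (σ r e)
  | z r _, z _ _ => root r
  | w _, y r e | y r e, w _ => y (oth r e) e
  | y _ e, y _ _ => w e
  | _, _ => c

/-- The third vertices of the triangles decomposing the union of the absorber and `L`, again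
without meaning on pairs that are not adjacent. -/
noncomputable def thirdWith : AbsorberVertex R → AbsorberVertex R → AbsorberVertex R
  | root r, root s => w s(r, s)
  | root r, w e | w e, root r => root (oth r e)
  | root _, u r e | u r e, root _ => z r e
  | root _, z r e | z r e, root _ => u r e
  | u r _, z _ _ | z _ _, u r _ => root r
  | w _, u r e | u r e, w _ => y r e
  | u _ _, y _ e | y _ e, u _ _ => w e
  | w _, y r e | y r e, w _ => u r e
  | y _ _, z r e | z r e, y _ _ => if r = lo e then b e else a e
  | a _, z r e | z r e, a _ => y r e
  | b _, z r e | z r e, b _ => y r e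
  | a e', y r e | y r e, a e' => if e' = ρ e then y (oth r e) e else z r e
  | b _, y r e | y r e, b _ => z r e
  | y _ e, y _ _ => a (ρ e)
  | c, z r e | z r e, c => z r (σ r e)
  | z _ _, z _ _ => c
  | c, b e | b e, c => a (ρ e)
  | c, a e | a e, c => b (ρ (ρ e))
  | a _, b _ | b _, a _ => c
  | a e, a e' => if e' = ρ e then a (ρ e') else a (ρ e)
  | _, _ => c

variable {L σ ρ}

theorem lo_ne_hi {e : Sym2 R} (he : e ∈ L.edgeSet) : lo e ≠ hi e := by
  rw [← lo_hi e] at he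
  exact SimpleGraph.Adj.ne he

theorem lo_mem (e : Sym2 R) : lo e ∈ e := by
  simpa only [lo_hi] using Sym2.mem_mk_left (lo e) (hi e)

theorem hi_mem (e : Sym2 R) : hi e ∈ e := by
  simpa only [lo_hi] using Sym2.mem_mk_right (lo e) (hi e)

theorem mem_iff_lo_hi {r : R} {e : Sym2 R} : r ∈ e ↔ r = lo e ∨ r = hi e := by
  conv_lhs => rw [← lo_hi e]
  simp

theorem oth_lo (e : Sym2 R) : oth (lo e) e = hi e := by simp [oth]

theorem oth_hi {e : Sym2 R} (he : e ∈ L.edgeSet) : oth (hi e) e = lo e := by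
  simp [oth, (lo_ne_hi he).symm]

variable (L σ ρ) in
/-- `σ r` is a fixed-point-free involution of the edges of `L` at `r`, for every `r`, and `ρ` is a
permutation of the edges of `L` all of whose cycles have length three. -/
structure IsAbsorberPairing : Prop where
  mem_σ : ∀ r, ∀ e ∈ L.edgeSet, r ∈ e → σ r e ∈ L.edgeSet
  end_σ : ∀ r, ∀ e ∈ L.edgeSet, r ∈ e → r ∈ σ r e
  σ_σ : ∀ r, ∀ e ∈ L.edgeSet, r ∈ e → σ r (σ r e) = e
  σ_ne : ∀ r, ∀ e ∈ L.edgeSet, r ∈ e → σ r e ≠ e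
  mem_ρ : ∀ e ∈ L.edgeSet, ρ e ∈ L.edgeSet
  ρ_ρ_ρ : ∀ e ∈ L.edgeSet, ρ (ρ (ρ e)) = e
  ρ_ne : ∀ e ∈ L.edgeSet, ρ e ≠ e

theorem IsAbsorberPairing.ρ_ρ_ne (h : IsAbsorberPairing L σ ρ) {e : Sym2 R} (he : e ∈ L.edgeSet) :
    ρ (ρ e) ≠ e := by
  have h1 := h.ρ_ρ_ρ e he
  have h2 := h.ρ_ne e he
  grind

theorem IsAbsorberPairing.not_back_self (h : IsAbsorberPairing L σ ρ) (x : AbsorberVertex R) :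
    ¬ Back L σ ρ x x := by
  cases x with
  | a e =>
    rintro ⟨he, h1⟩
    rcases h1 with h1 | h1
    · exact h.ρ_ne e he h1.symm
    · exact h.ρ_ρ_ne he h1.symm
  | z r e => rintro ⟨he, hr, -, h2⟩; exact h.σ_ne r e he hr h2.symm
  | y r e =>
    rintro ⟨he, h1, h2, -⟩
    have := lo_ne_hi he
    rw [mem_iff_lo_hi] at h1
    unfold oth at h2
    grind
  | _ => exact id

theorem IsAbsorberPairing.absorber_adj (h : IsAbsorberPairing L σ ρ) {x y : AbsorberVertex R} :
    (absorber L σ ρ).Adj x y ↔ Back L σ ρ x y ∨ Back L σ ρ y x := by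
  rw [absorber, SimpleGraph.fromRel_adj, and_iff_right_iff_imp]
  rintro hxy rfl
  exact h.not_back_self x (or_self_iff.1 hxy)

/-- The two ends of an edge of the absorber form a triangle with `thirdWithout`, and each edge of
this triangle yields the opposite vertex; this is checked for every type of edge. -/
theorem IsAbsorberPairing.thirdWithout_spec (h : IsAbsorberPairing L σ ρ)
    (x y : AbsorberVertex R) : Back L σ ρ x y →
      thirdWithout σ ρ x y = thirdWithout σ ρ y x ∧
      (Back L σ ρ x (thirdWithout σ ρ x y) ∨ Back L σ ρ (thirdWithout σ ρ x y) x) ∧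
      (Back L σ ρ y (thirdWithout σ ρ x y) ∨ Back L σ ρ (thirdWithout σ ρ x y) y) ∧
      thirdWithout σ ρ x (thirdWithout σ ρ x y) = y ∧
      thirdWithout σ ρ y (thirdWithout σ ρ x y) = x := by
    intro hxy
    cases x <;> cases y <;> simp only [Back] at hxy
    all_goals
      first
      | obtain ⟨he, hxy⟩ := hxy
      | have he := hxy
      have h1 := lo_ne_hi he
      have h2 := h1.symm
      have h3 := h.mem_ρ _ he
      have h4 := h.mem_ρ _ h3
      have h5 := h.ρ_ρ_ρ _ he
      have h6 := h.ρ_ne _ he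
      have h7 := h.ρ_ρ_ne he
      have h8 := h.ρ_ne _ h3
      have h9 := @oth_lo R
      have h10 := oth_hi he
      have h11 := lo_ne_hi h3
      have h12 := lo_ne_hi h4
      have h20 := h12.symm
      have h17 := h6.symm
      have h18 := h7.symm
      have h19 := h8.symm
    all_goals try
      first
      | have hr := hxy.1
      | have hr := hxy
      have h13 := h.σ_σ _ _ he hr
      have h14 := h.σ_ne _ _ he hr
      have h15 := h.mem_σ _ _ he hr
      have h16 := h.end_σ _ _ he hr
      rw [mem_iff_lo_hi] at hr
    all_goals first
      | (simp [Back, thirdWithout, lo_mem, hi_mem, *]; done)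
      | (rcases hr with rfl | rfl <;> simp [Back, thirdWithout, lo_mem, hi_mem, *]; done)
      | (rcases hxy with rfl | rfl <;> simp [Back, thirdWithout, lo_mem, hi_mem, *])
      | (rcases hr with rfl | rfl
         · rcases hxy.2 with ⟨-, hxy⟩ | rfl
           · exact absurd rfl hxy
           · simp [Back, thirdWithout, lo_mem, hi_mem, *]
         · rcases hxy.2 with ⟨rfl, -⟩ | rfl <;> simp [Back, thirdWithout, lo_mem, hi_mem, *])
      | (rcases hr with rfl | rfl
         · exact absurd rfl hxy.2.2
         · obtain ⟨-, rfl, -⟩ := hxy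
           simp [Back, thirdWithout, lo_mem, hi_mem, *])

theorem IsAbsorberPairing.hasTriangleDecomposition_absorber (h : IsAbsorberPairing L σ ρ) :
    HasTriangleDecomposition (absorber L σ ρ) := by
  refine hasTriangleDecomposition_of_third (thirdWithout σ ρ) ?_ ?_ ?_
  all_goals
    intro x y hxy
    simp only [h.absorber_adj] at hxy ⊢
    rcases hxy with hxy | hxy
  · exact (h.thirdWithout_spec x y hxy).1
  · exact (h.thirdWithout_spec y x hxy).1.symm
  · exact (h.thirdWithout_spec x y hxy).2.1
  · rw [← (h.thirdWithout_spec y x hxy).1]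
    exact (h.thirdWithout_spec y x hxy).2.2.1
  · exact (h.thirdWithout_spec x y hxy).2.2.2.1
  · rw [← (h.thirdWithout_spec y x hxy).1]
    exact (h.thirdWithout_spec y x hxy).2.2.2.2

theorem adj_lo_hi {e : Sym2 R} (he : e ∈ L.edgeSet) : L.Adj (lo e) (hi e) := by
  rwa [← lo_hi e] at he

variable (L) in
/-- The edges of `L`, on the roots of its absorber. -/
def RootAdj : AbsorberVertex R → AbsorberVertex R → Prop
  | root r, root s => L.Adj r s
  | _, _ => False

theorem rootAdj_iff {x y : AbsorberVertex R} :
    RootAdj L x y ↔ ∃ r s, L.Adj r s ∧ x = root r ∧ y = root s := by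
  cases x <;> cases y <;> simp [RootAdj]

variable (L) in
/-- The copy of `L` on the roots of its absorber. -/
def rootCopy : SimpleGraph (AbsorberVertex R) := L.map root

theorem rootCopy_adj {x y : AbsorberVertex R} : (rootCopy L).Adj x y ↔ RootAdj L x y := by
  rw [rootCopy, SimpleGraph.map_adj', rootAdj_iff]
  constructor
  · rintro ⟨-, r, s, h, rfl, rfl⟩
    exact ⟨r, s, h, rfl, rfl⟩
  · rintro ⟨r, s, h, rfl, rfl⟩
    exact ⟨by simpa using h.ne, r, s, h, rfl, rfl⟩

/-- The analogue of `thirdWithout_spec` for the union of the absorber and `L`. -/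
theorem IsAbsorberPairing.thirdWith_spec (h : IsAbsorberPairing L σ ρ)
    (x y : AbsorberVertex R) : Back L σ ρ x y →
      thirdWith σ ρ x y = thirdWith σ ρ y x ∧
      (Back L σ ρ x (thirdWith σ ρ x y) ∨ Back L σ ρ (thirdWith σ ρ x y) x ∨
        RootAdj L x (thirdWith σ ρ x y)) ∧
      (Back L σ ρ y (thirdWith σ ρ x y) ∨ Back L σ ρ (thirdWith σ ρ x y) y ∨
        RootAdj L y (thirdWith σ ρ x y)) ∧
      thirdWith σ ρ x (thirdWith σ ρ x y) = y ∧
      thirdWith σ ρ y (thirdWith σ ρ x y) = x := by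
    intro hxy
    cases x <;> cases y <;> simp only [Back] at hxy
    all_goals
      first
      | obtain ⟨he, hxy⟩ := hxy
      | have he := hxy
      have h1 := lo_ne_hi he
      have h2 := h1.symm
      have h3 := h.mem_ρ _ he
      have h4 := h.mem_ρ _ h3
      have h5 := h.ρ_ρ_ρ _ he
      have h6 := h.ρ_ne _ he
      have h7 := h.ρ_ρ_ne he
      have h8 := h.ρ_ne _ h3
      have h9 := @oth_lo R
      have h10 := oth_hi he
      have h11 := lo_ne_hi h3
      have h12 := lo_ne_hi h4
      have h20 := h12.symm
      have h21 := adj_lo_hi he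
      have h22 := h21.symm
      have h23 := @lo_hi R
      have h24 : ∀ e : Sym2 R, s(hi e, lo e) = e := fun e => Sym2.eq_swap.trans (h23 e)
      have h17 := h6.symm
      have h18 := h7.symm
      have h19 := h8.symm
    all_goals try
      first
      | have hr := hxy.1
      | have hr := hxy
      have h13 := h.σ_σ _ _ he hr
      have h14 := h.σ_ne _ _ he hr
      have h15 := h.mem_σ _ _ he hr
      have h16 := h.end_σ _ _ he hr
      rw [mem_iff_lo_hi] at hr
    all_goals first
      | (simp [Back, RootAdj, thirdWith, lo_mem, hi_mem, *]; done)
      | (rcases hr with rfl | rfl <;> simp [Back, RootAdj, thirdWith, lo_mem, hi_mem, *]; done)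
      | (rcases hxy with rfl | rfl <;> simp [Back, RootAdj, thirdWith, lo_mem, hi_mem, *])
      | (rcases hr with rfl | rfl
         · rcases hxy.2 with ⟨-, hxy⟩ | rfl
           · exact absurd rfl hxy
           · simp [Back, RootAdj, thirdWith, lo_mem, hi_mem, *]
         · rcases hxy.2 with ⟨rfl, -⟩ | rfl <;>
             simp [Back, RootAdj, thirdWith, lo_mem, hi_mem, *])

theorem oth_left {r s : R} (h : r ≠ s) : oth r s(r, s) = s := by
  have h1 := lo_hi s(r, s)
  unfold oth
  rw [Sym2.eq_iff] at h1
  grind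

theorem thirdWith_root_root {r s : R} (h : L.Adj r s) :
    thirdWith σ ρ (root r) (root s) = w s(r, s) ∧ thirdWith σ ρ (root s) (root r) = w s(r, s) ∧
    Back L σ ρ (w s(r, s)) (root r) ∧
    thirdWith σ ρ (root r) (w s(r, s)) = root s := by
  refine ⟨rfl, by rw [Sym2.eq_swap]; rfl, ⟨h, by simp⟩, ?_⟩
  simp [thirdWith, oth_left h.ne]

theorem IsAbsorberPairing.hasTriangleDecomposition_absorber_sup (h : IsAbsorberPairing L σ ρ) :
    HasTriangleDecomposition (absorber L σ ρ ⊔ rootCopy L) := by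
  refine hasTriangleDecomposition_of_third (thirdWith σ ρ) ?_ ?_ ?_
  all_goals
    intro x y hxy
    simp only [SimpleGraph.sup_adj, h.absorber_adj, rootCopy_adj, or_assoc] at hxy ⊢
    rcases hxy with hxy | hxy | hxy
  · exact (h.thirdWith_spec x y hxy).1
  · exact (h.thirdWith_spec y x hxy).1.symm
  · obtain ⟨r, s, hrs, rfl, rfl⟩ := rootAdj_iff.1 hxy
    rw [(thirdWith_root_root hrs).1, (thirdWith_root_root hrs).2.1]
  · exact (h.thirdWith_spec x y hxy).2.1
  · rw [← (h.thirdWith_spec y x hxy).1]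
    exact (h.thirdWith_spec y x hxy).2.2.1
  · obtain ⟨r, s, hrs, rfl, rfl⟩ := rootAdj_iff.1 hxy
    exact Or.inr (Or.inl (thirdWith_root_root hrs).2.2.1)
  · exact (h.thirdWith_spec x y hxy).2.2.2.1
  · rw [← (h.thirdWith_spec y x hxy).1]
    exact (h.thirdWith_spec y x hxy).2.2.2.2
  · obtain ⟨r, s, hrs, rfl, rfl⟩ := rootAdj_iff.1 hxy
    rw [(thirdWith_root_root hrs).1, (thirdWith_root_root hrs).2.2.2]

/-- An edge of the absorber is directed towards a root or a vertex of smaller rank, or in both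
ways. -/
theorem IsAbsorberPairing.back_rank (h : IsAbsorberPairing L σ ρ) (x y : AbsorberVertex R)
    (hxy : Back L σ ρ x y) :
    (∃ r, y = root r) ∨ rank y < rank x ∨ Back L σ ρ y x := by
  cases x <;> cases y <;> simp only [Back] at hxy <;> simp only [rank, Back] <;> try simp
  · obtain ⟨he, rfl | rfl⟩ := hxy
    · exact ⟨h.mem_ρ _ he, Or.inr (h.ρ_ρ_ρ _ he).symm⟩
    · exact ⟨h.mem_ρ _ (h.mem_ρ _ he), Or.inl (h.ρ_ρ_ρ _ he).symm⟩
  · obtain ⟨he, hr, rfl, rfl⟩ := hxy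
    exact ⟨h.mem_σ _ _ he hr, h.end_σ _ _ he hr, rfl, (h.σ_σ _ _ he hr).symm⟩
  · obtain ⟨he, hr, rfl, rfl⟩ := hxy
    rw [mem_iff_lo_hi] at hr
    rcases hr with rfl | rfl
    · simp [oth_lo, oth_hi he, he, hi_mem]
    · simp [oth_lo, oth_hi he, he, lo_mem]

/-- Every vertex of the absorber has at most four neighbours of at most its own rank. -/
theorem exists_back_subset (x : AbsorberVertex R) :
    ∃ Q : Finset (AbsorberVertex R), Q.card ≤ 4 ∧ ∀ y, Back L σ ρ x y → y ∈ Q := by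
  let Q : Finset (AbsorberVertex R) := match x with
    | root r => ∅
    | c => ∅
    | a e => {c, a (ρ e), a (ρ (ρ e))}
    | b e => {c, a (ρ e)}
    | z r e => {root r, c, if r = lo e then b e else a e, z r (σ r e)}
    | y r e => {if r = lo e then b e else a e, a (ρ e), z r e, y (oth r e) e}
    | w e => {root (lo e), root (hi e), y (lo e) e, y (hi e) e}
    | u r e => {root r, w e, z r e, y r e}
  refine ⟨Q, ?_, ?_⟩
  · cases x <;> simp only [Q]
    all_goals first
      | exact Finset.card_le_four
      | exact Finset.card_le_three.trans (by norm_num)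
      | exact Finset.card_le_two.trans (by norm_num)
      | simp
  · intro y hy
    cases x <;> cases y <;> simp only [Back, mem_iff_lo_hi] at hy <;> simp only [Q] <;> grind

/-- A finite set whose size is a multiple of `k ≥ 2` has a permutation with all cycles of length
dividing `k` and without fixed points. -/
theorem exists_cyclic_map {α : Type*} {k : ℕ} (hk : 2 ≤ k) (s : Finset α) (hs : k ∣ s.card) :
    ∃ f : α → α, ∀ x ∈ s, f x ∈ s ∧ f^[k] x = x ∧ f x ≠ x := by
  obtain ⟨m, hm⟩ := hs
  have : NeZero k := ⟨by omega⟩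
  have : Fact (1 < k) := ⟨by omega⟩
  let e : s ≃ Fin m × ZMod k := Fintype.equivOfCardEq (by
    rw [Fintype.card_coe, hm, Fintype.card_prod, Fintype.card_fin, ZMod.card, mul_comm])
  let g : s → s := fun x => e.symm ((e x).1, (e x).2 + 1)
  have hg : ∀ (n : ℕ) (x : s), g^[n] x = e.symm ((e x).1, (e x).2 + n) := by
    intro n x
    induction n with
    | zero => simp
    | succ n ih =>
      rw [Function.iterate_succ_apply', ih]
      simp [g, add_assoc]
  let f : α → α := fun x => if h : x ∈ s then g ⟨x, h⟩ else x
  have hf : ∀ (n : ℕ) (x : s), f^[n] x = g^[n] x := by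
    intro n x
    induction n with
    | zero => rfl
    | succ n ih =>
      rw [Function.iterate_succ_apply', Function.iterate_succ_apply', ih]
      simp [f]
  refine ⟨f, fun x hx => ⟨?_, ?_, ?_⟩⟩
  · have := hf 1 ⟨x, hx⟩
    simp only [Function.iterate_one] at this
    rw [this]
    exact (g ⟨x, hx⟩).2
  · rw [hf k ⟨x, hx⟩, hg]
    simp
  · have := hf 1 ⟨x, hx⟩
    simp only [Function.iterate_one] at this
    rw [this]
    intro h
    have h2 : g ⟨x, hx⟩ = ⟨x, hx⟩ := Subtype.ext h
    have h3 := congrArg (fun z => (e z).2) h2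
    simp [g] at h3

theorem exists_isAbsorberPairing [Fintype R] (L : SimpleGraph R)
    (heven : ∀ r, Even (degIn L r univ)) (hthree : 3 ∣ L.edgeSet.ncard) :
    ∃ σ ρ, IsAbsorberPairing L σ ρ := by
  have hσ : ∀ r, ∃ f : Sym2 R → Sym2 R, ∀ e, e ∈ L.edgeSet ∧ r ∈ e →
      (f e ∈ L.edgeSet ∧ r ∈ f e) ∧ f (f e) = e ∧ f e ≠ e := by
    intro r
    have hcard : ((univ.filter (L.Adj r)).image fun x => s(r, x)).card = degIn L r univ := by
      rw [Finset.card_image_of_injective]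
      · rfl
      · intro x y h
        exact Sym2.congr_right.1 h
    obtain ⟨f, hf⟩ := exists_cyclic_map le_rfl _ (hcard ▸ (heven r).two_dvd)
    have hmem : ∀ e, e ∈ ((univ.filter (L.Adj r)).image fun x => s(r, x)) ↔
        e ∈ L.edgeSet ∧ r ∈ e := by
      intro e
      simp only [Finset.mem_image, Finset.mem_filter, Finset.mem_univ, true_and]
      constructor
      · rintro ⟨x, hx, rfl⟩
        exact ⟨hx, by simp⟩
      · rintro ⟨he, x, rfl⟩
        exact ⟨x, he, rfl⟩
    refine ⟨f, fun e he => ?_⟩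
    rw [← hmem] at he ⊢
    exact hf e he
  choose σ hσ using hσ
  have hcard : (univ.filter (· ∈ L.edgeSet)).card = L.edgeSet.ncard := by
    rw [← Set.ncard_coe_finset]
    simp
  obtain ⟨ρ, hρ⟩ := exists_cyclic_map (by norm_num : 2 ≤ 3) _ (hcard ▸ hthree)
  simp only [Finset.mem_filter, Finset.mem_univ, true_and] at hρ
  exact ⟨σ, ρ, ⟨fun r e he hr => (hσ r e ⟨he, hr⟩).1.1, fun r e he hr => (hσ r e ⟨he, hr⟩).1.2,
    fun r e he hr => (hσ r e ⟨he, hr⟩).2.1, fun r e he hr => (hσ r e ⟨he, hr⟩).2.2,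
    fun e he => (hρ e he).1, fun e he => (hρ e he).2.1, fun e he => (hρ e he).2.2⟩⟩

end AbsorberVertex

open AbsorberVertex in
/-- Every triangle-divisible graph `L` on a set `R` of roots has an absorber in a graph `G` in
which any four vertices have many common neighbours. The vertices of the absorber other than the
roots avoid a given set `B`. -/
theorem exists_absorber {V R : Type*} [Fintype V] [Fintype R] (ι : R ↪ V) (G : SimpleGraph V)
    (L : SimpleGraph R) (heven : ∀ r, Even (degIn L r univ)) (hthree : 3 ∣ L.edgeSet.ncard)
    (B : Finset V)
    (hG : ∀ Q : Finset V, Q.card ≤ 4 → B.card + Nat.card (AbsorberVertex R) <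
      (univ.filter fun v => ∀ q ∈ Q, G.Adj v q).card) :
    ∃ (A : SimpleGraph V) (N : Finset V), A ≤ G ∧ N.card ≤ Nat.card (AbsorberVertex R) ∧
      (∀ x ∈ N, x ∉ B) ∧
      (∀ x y, A.Adj x y → (x ∈ N ∨ y ∈ N) ∧ (x ∈ N ∨ ∃ r, ι r = x)) ∧
      HasTriangleDecomposition A ∧ HasTriangleDecomposition (A ⊔ L.map ι) := by
  obtain ⟨σ, ρ, h⟩ := exists_isAbsorberPairing L heven hthree
  let _ : Fintype (AbsorberVertex R) := Fintype.ofFinite _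
  let isRoot : AbsorberVertex R → Prop := fun x => ∃ r, x = root r
  rw [Nat.card_eq_fintype_card] at hG ⊢
  rcases isEmpty_or_nonempty V with hV | ⟨⟨v₀⟩⟩
  · exact absurd (hG ∅ (by simp)) (by simp)
  let φ₀ : AbsorberVertex R → V := fun x => match x with
    | root r => ι r
    | _ => v₀
  obtain ⟨φ, hinj, hroot, hnew, hadj⟩ := exists_embedding_of_degenerate G B (Back L σ ρ) isRoot
    rank h.back_rank h.not_back_self (fun x _ => exists_back_subset x) hG φ₀ (by
      rintro _ ⟨r, rfl⟩ _ ⟨s, rfl⟩ hrs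
      rw [ι.injective hrs])
  have hroot' : ∀ r, φ (root r) = ι r := fun r => hroot _ ⟨r, rfl⟩
  have hback : ∀ x y, Back L σ ρ x y → ¬ isRoot x := by
    rintro _ y hxy ⟨r, rfl⟩
    cases y <;> exact hxy
  refine ⟨(absorber L σ ρ).map (⟨φ, hinj⟩ : AbsorberVertex R ↪ V),
    (univ.filter fun x => ¬ isRoot x).image φ, ?_, ?_, ?_, ?_, ?_, ?_⟩
  · rintro _ _ ⟨-, x, y, hxy, rfl, rfl⟩
    rcases h.absorber_adj.1 hxy with h1 | h1
    · exact hadj x y (hback _ _ h1) h1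
    · exact (hadj y x (hback _ _ h1) h1).symm
  · exact Finset.card_image_le.trans (Finset.card_le_univ _)
  · simp only [Finset.mem_image, Finset.mem_filter, Finset.mem_univ, true_and]
    rintro _ ⟨x, hx, rfl⟩
    exact hnew x hx
  · rintro _ _ ⟨-, x, y, hxy, rfl, rfl⟩
    have hmem : ∀ z, ¬ isRoot z → φ z ∈ (univ.filter fun x => ¬ isRoot x).image φ :=
      fun z hz => Finset.mem_image_of_mem φ (by simpa using hz)
    refine ⟨?_, ?_⟩
    · rcases h.absorber_adj.1 hxy with h1 | h1
      · exact Or.inl (hmem _ (hback _ _ h1))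
      · exact Or.inr (hmem _ (hback _ _ h1))
    · by_cases hx : isRoot x
      · obtain ⟨r, rfl⟩ := hx
        exact Or.inr ⟨r, (hroot' r).symm⟩
      · exact Or.inl (hmem _ hx)
  · exact h.hasTriangleDecomposition_absorber.map _
  · have := h.hasTriangleDecomposition_absorber_sup.map (⟨φ, hinj⟩ : AbsorberVertex R ↪ V)
    convert this using 1
    ext v w
    simp only [SimpleGraph.sup_adj, SimpleGraph.map_adj, rootCopy_adj, rootAdj_iff]
    constructor
    · rintro (⟨x, y, hxy, rfl, rfl⟩ | ⟨r, s, hrs, rfl, rfl⟩)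
      · exact ⟨x, y, Or.inl hxy, rfl, rfl⟩
      · exact ⟨root r, root s, Or.inr ⟨r, s, hrs, rfl, rfl⟩, hroot' r, hroot' s⟩
    · rintro ⟨x, y, hxy | ⟨r, s, hrs, rfl, rfl⟩, rfl, rfl⟩
      · exact Or.inl ⟨x, y, hxy, rfl, rfl⟩
      · exact Or.inr ⟨r, s, hrs, (hroot' r).symm, (hroot' s).symm⟩

end Absorber

end

section

open Classical Finset

/-! ### Balanced colourings -/

section Colouring

theorem sum_exp_le_of_sum_eq_zero {C : Type*} [Fintype C] (y : C → ℝ) {l : ℝ} (hl : l ≤ 1)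
    (hy : ∀ c, |y c| ≤ l) (hsum : ∑ c, y c = 0) :
    ∑ c, Real.exp (y c) ≤ Fintype.card C * Real.exp (l ^ 2) := by
  have h1 : ∀ c, Real.exp (y c) ≤ 1 + y c + l ^ 2 := by
    intro c
    have h2 := Real.abs_exp_sub_one_sub_id_le ((hy c).trans hl)
    have h3 : y c ^ 2 ≤ l ^ 2 := sq_le_sq' (by linarith [abs_le.1 (hy c)]) (abs_le.1 (hy c)).2
    linarith [le_abs_self (Real.exp (y c) - 1 - y c)]
  calc ∑ c, Real.exp (y c) ≤ ∑ c, (1 + y c + l ^ 2) := Finset.sum_le_sum fun c _ => h1 c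
    _ = Fintype.card C * (l ^ 2 + 1) := by
      simp only [Finset.sum_add_distrib, hsum]
      simp
      ring
    _ ≤ _ := by
      gcongr
      exact Real.add_one_le_exp _

/-- Finitely many subsets `S j` of `V` can be split evenly by one colouring of `V`. The bound is the
exponential moment bound for a uniformly random colouring, averaged over all `j` and all
colours. -/
theorem exists_balanced_colouring {V J C : Type*} [Fintype V] [Fintype J] [Fintype C]
    [Nonempty C] (S : J → Finset V) {l : ℝ} (hl0 : 0 < l) (hl1 : l ≤ 1) :
    ∃ χ : V → C, ∀ j c,
      |(((S j).filter fun v => χ v = c).card : ℝ) - (S j).card / Fintype.card C| ≤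
        Fintype.card V * l + Real.log (2 * Fintype.card J * Fintype.card C) / l := by
  set q : ℝ := (Fintype.card C : ℝ) with hq
  have hqpos : 0 < q := by
    rw [hq]
    exact_mod_cast Fintype.card_pos
  have hq1 : 1 ≤ q := by
    rw [hq]
    exact_mod_cast Fintype.card_pos
  -- the contribution of `v` with colour `d` to the deviation of the colour class `c` on `S j`
  let x : J → C → V → C → ℝ := fun j c v d =>
    if v ∈ S j then ((if d = c then 1 else 0) - 1 / q) else 0
  let sg : Bool → ℝ := fun b => if b then 1 else -1
  let g : J × C × Bool → (V → C) → ℝ := fun k χ =>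
    ∏ v, Real.exp (sg k.2.2 * l * x k.1 k.2.1 v (χ v))
  have hsg : ∀ b, |sg b| = 1 := by
    intro b
    cases b <;> simp [sg]
  have hg : ∀ k, ∑ χ, g k χ ≤ (q * Real.exp (l ^ 2)) ^ Fintype.card V := by
    intro ⟨j, c, b⟩
    have h1 : ∑ χ, g (j, c, b) χ = ∏ v, ∑ d, Real.exp (sg b * l * x j c v d) := by
      rw [Finset.prod_univ_sum, Fintype.piFinset_univ]
    rw [h1, ← Finset.card_univ, ← Finset.prod_const]
    refine Finset.prod_le_prod (fun v _ => Finset.sum_nonneg fun _ _ => (Real.exp_pos _).le)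
      fun v _ => ?_
    refine sum_exp_le_of_sum_eq_zero _ hl1 (fun d => ?_) ?_
    · rw [abs_mul, abs_mul, hsg, one_mul, abs_of_pos hl0]
      refine mul_le_of_le_one_right hl0.le ?_
      have h2 : 0 ≤ 1 / q := by positivity
      have h3 : 1 / q ≤ 1 := by rw [div_le_one hqpos]; exact hq1
      simp only [x]
      split_ifs <;> rw [abs_le] <;> constructor <;> linarith
    · rw [← Finset.mul_sum]
      simp only [x]
      split_ifs
      · rw [Finset.sum_sub_distrib]
        simp [← hq, hqpos.ne']
      · simp
  obtain ⟨χ, -, hχ⟩ := Finset.exists_le_of_sum_le (s := (univ : Finset (V → C)))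
    (f := fun χ => ∑ k, g k χ)
    (g := fun _ => 2 * Fintype.card J * q * Real.exp (l ^ 2) ^ Fintype.card V)
    Finset.univ_nonempty (by
      rw [Finset.sum_comm, Finset.sum_const, Finset.card_univ, Fintype.card_fun, nsmul_eq_mul]
      refine (Finset.sum_le_sum fun k _ => hg k).trans (le_of_eq ?_)
      rw [Finset.sum_const, Finset.card_univ, Fintype.card_prod, Fintype.card_prod,
        Fintype.card_bool, nsmul_eq_mul, mul_pow]
      push_cast
      rw [← hq]
      ring)
  refine ⟨χ, fun j c => ?_⟩
  set D : ℝ := (((S j).filter fun v => χ v = c).card : ℝ) - (S j).card / q with hD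
  have hDx : D = ∑ v, x j c v (χ v) := by
    simp only [x]
    rw [← Finset.sum_filter, Finset.sum_sub_distrib, Finset.sum_const, ← Finset.sum_filter,
      Finset.sum_const, nsmul_eq_mul, nsmul_eq_mul, mul_one]
    simp [hD, div_eq_mul_inv]
  have hterm : ∀ b, l * (sg b * D) ≤ Fintype.card V * l ^ 2 +
      Real.log (2 * Fintype.card J * Fintype.card C) := by
    intro b
    have h1 : g (j, c, b) χ ≤ 2 * Fintype.card J * q * Real.exp (l ^ 2) ^ Fintype.card V :=
      (Finset.single_le_sum (f := fun k => g k χ)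
        (fun k _ => Finset.prod_nonneg fun _ _ => (Real.exp_pos _).le) (Finset.mem_univ _)).trans hχ
    have h2 : g (j, c, b) χ = Real.exp (l * (sg b * D)) := by
      simp only [g]
      rw [← Real.exp_sum, ← Finset.mul_sum, ← hDx]
      ring_nf
    have : Nonempty J := ⟨j⟩
    have hJ : (0 : ℝ) < Fintype.card J := by exact_mod_cast Fintype.card_pos
    rw [h2, ← Real.exp_nat_mul] at h1
    rw [← Real.exp_le_exp, Real.exp_add, Real.exp_log (by positivity)]
    linarith
  rw [show (Fintype.card V : ℝ) * l + Real.log (2 * Fintype.card J * q) / l =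
    (Fintype.card V * l ^ 2 + Real.log (2 * Fintype.card J * q)) / l by
      field_simp, le_div_iff₀ hl0]
  have h1 := hterm true
  have h2 := hterm false
  simp only [sg, if_true, Bool.false_eq_true, if_false] at h1 h2
  rcases abs_cases D with ⟨h, -⟩ | ⟨h, -⟩ <;> rw [h] <;> linarith

end Colouring

end

section

open Classical Finset

/-! ### Greedy covers by triangles -/

section GreedyCover

variable {V : Type*}

/-- The triangle with vertices `x`, `y`, `z` as a graph. -/
def triangleGraph (x y z : V) : SimpleGraph V :=
  SimpleGraph.fromRel fun a b => a ∈ ({x, y, z} : Finset V) ∧ b ∈ ({x, y, z} : Finset V)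

theorem triangleGraph_adj {x y z a b : V} : (triangleGraph x y z).Adj a b ↔
    a ≠ b ∧ (a = x ∨ a = y ∨ a = z) ∧ (b = x ∨ b = y ∨ b = z) := by
  simp only [triangleGraph, SimpleGraph.fromRel_adj, Finset.mem_insert, Finset.mem_singleton]
  tauto

theorem hasTriangleDecomposition_triangleGraph {x y z : V} (hxy : x ≠ y) (hxz : x ≠ z)
    (hyz : y ≠ z) : HasTriangleDecomposition (triangleGraph x y z) := by
  refine ⟨{{x, y, z}}, ?_, ?_⟩
  · rintro _ rfl
    rw [SimpleGraph.is3Clique_triple_iff]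
    simp [triangleGraph_adj, hxy, hxz, hyz]
  · intro u v huv
    rw [triangleGraph_adj] at huv
    exact ⟨{x, y, z}, ⟨rfl, by simpa using huv.2.1, by simpa using huv.2.2⟩, fun t ht => ht.1⟩

theorem degIn_sup_le (G H : SimpleGraph V) (x : V) (S : Finset V) :
    degIn (G ⊔ H) x S ≤ degIn G x S + degIn H x S := by
  refine le_trans (Finset.card_le_card ?_) (Finset.card_union_le _ _)
  intro y
  simp only [Finset.mem_filter, Finset.mem_union, SimpleGraph.sup_adj]
  tauto

theorem degIn_edge_le [Fintype V] (a b v : V) :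
    degIn (SimpleGraph.edge a b) v univ ≤ (if v = a then 1 else 0) + if v = b then 1 else 0 := by
  refine (Finset.card_le_card (t := (if v = a then {b} else ∅) ∪ if v = b then {a} else ∅) ?_).trans
    ((Finset.card_union_le _ _).trans ?_)
  · intro u
    simp only [Finset.mem_filter, Finset.mem_univ, true_and, SimpleGraph.edge_adj]
    grind
  · split_ifs <;> simp

theorem card_filter_mem_le_degIn [Fintype V] {E : SimpleGraph V} {F : Finset (Sym2 V)}
    (hF : ∀ e ∈ F, e ∈ E.edgeSet) (x : V) : (F.filter (x ∈ ·)).card ≤ degIn E x univ := by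
  have h : F.filter (x ∈ ·) ⊆ (univ.filter (E.Adj x)).image fun y => s(x, y) := by
    intro e he
    rw [Finset.mem_filter] at he
    obtain ⟨he, y, rfl⟩ := he
    exact Finset.mem_image_of_mem _ (by simpa using hF _ he)
  exact (Finset.card_le_card h).trans Finset.card_image_le

theorem two_mul_card_le_of_degIn_le [Fintype V] {E : SimpleGraph V} {F : Finset (Sym2 V)}
    (hF : ∀ e ∈ F, e ∈ E.edgeSet) {d : ℕ} (hd : ∀ x, degIn E x univ ≤ d) :
    2 * F.card ≤ Fintype.card V * d := by
  have h1 : F.card ≤ E.edgeFinset.card := Finset.card_le_card fun e he => by simpa using hF e he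
  have h2 := E.sum_degrees_eq_twice_card_edges
  have h3 : ∑ v, E.degree v ≤ ∑ _v : V, d :=
    Finset.sum_le_sum fun v _ => (degree_eq_degIn E v).le.trans (hd v)
  rw [Finset.sum_const, Finset.card_univ, smul_eq_mul] at h3
  omega

/-- A graph `E` of maximum degree at most `d`, each of whose edges has at least `s` common
neighbours in an edge-disjoint graph `Q`, is covered greedily by edge-disjoint triangles with two
edges in `Q`. The third vertices are chosen among those of degree at most `b` in the part `Q'` of
`Q` that is already used, and this keeps the degrees in `Q'` at most `b + 2 + d`. -/
theorem exists_greedy_cover [Fintype V] (E Q : SimpleGraph V) (hEQ : ∀ x y, E.Adj x y → ¬ Q.Adj x y)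
    (d b s : ℕ) (hd : ∀ x, degIn E x univ ≤ d)
    (hs : ∀ x y, E.Adj x y → s ≤ (univ.filter fun z => Q.Adj x z ∧ Q.Adj y z).card)
    (hlt : 2 * (b + 2 + d) * (b + 1) + 2 * (Fintype.card V * d) < s * (b + 1)) :
    ∃ Q' ≤ Q, HasTriangleDecomposition (E ⊔ Q') ∧ ∀ x, degIn Q' x univ ≤ b + 2 + d := by
  have key : ∀ F : Finset (Sym2 V), (∀ e ∈ F, e ∈ E.edgeSet) →
      ∃ Q' ≤ Q, HasTriangleDecomposition (SimpleGraph.fromEdgeSet (F : Set (Sym2 V)) ⊔ Q') ∧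
        (∀ x, degIn Q' x univ ≤ b + 2 + (F.filter (x ∈ ·)).card) ∧
        ∑ x, degIn Q' x univ ≤ 4 * F.card := by
    intro F
    induction F using Finset.induction_on with
    | empty =>
      intro _
      refine ⟨⊥, bot_le, ?_, ?_, ?_⟩
      · simpa using hasTriangleDecomposition_bot
      · intro x
        simp [degIn]
      · simp [degIn]
    | insert e F heF ih =>
      intro hF
      obtain ⟨Q', hQ', hdec, hdeg, hsum⟩ := ih fun e' he' => hF e' (Finset.mem_insert_of_mem he')
      have he := hF e (Finset.mem_insert_self _ _)
      have hFE : ∀ e' ∈ F, e' ∈ E.edgeSet := fun e' he' => hF e' (Finset.mem_insert_of_mem he')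
      induction e with
      | _ x y =>
      have hE : E.Adj x y := he
      -- the vertices whose degree in `Q'` is already large are avoided as third vertices
      set O : Finset V := univ.filter fun z => b < degIn Q' z univ with hO
      have hOcard : O.card * (b + 1) ≤ 2 * (Fintype.card V * d) := by
        have h1 : O.card * (b + 1) ≤ ∑ z, degIn Q' z univ := by
          rw [← smul_eq_mul, ← Finset.sum_const]
          refine (Finset.sum_le_sum fun z hz => ?_).trans
            (Finset.sum_le_sum_of_subset (Finset.subset_univ O))
          exact (Finset.mem_filter.1 hz).2
        have h2 := two_mul_card_le_of_degIn_le hFE hd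
        omega
      have hdeg' : ∀ v, degIn Q' v univ ≤ b + 2 + d := fun v =>
        (hdeg v).trans (Nat.add_le_add_left ((card_filter_mem_le_degIn hFE v).trans (hd v)) _)
      obtain ⟨z, hz, hzbad⟩ : ∃ z ∈ univ.filter fun z => Q.Adj x z ∧ Q.Adj y z,
          z ∉ (univ.filter (Q'.Adj x) ∪ univ.filter (Q'.Adj y)) ∪ O := by
        refine Finset.exists_mem_notMem_of_card_lt_card (lt_of_lt_of_le ?_ (hs x y hE))
        refine (Finset.card_union_le _ _).trans_lt
          ((Nat.add_le_add_right (Finset.card_union_le _ _) _).trans_lt ?_)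
        have h1 : (univ.filter (Q'.Adj x)).card ≤ b + 2 + d := hdeg' x
        have h2 : (univ.filter (Q'.Adj y)).card ≤ b + 2 + d := hdeg' y
        refine lt_of_mul_lt_mul_right (lt_of_le_of_lt ?_ hlt) (Nat.zero_le (b + 1))
        nlinarith
      simp only [Finset.mem_filter, Finset.mem_univ, true_and] at hz
      simp only [hO, Finset.mem_union, Finset.mem_filter, Finset.mem_univ, true_and, not_or,
        not_lt] at hzbad
      obtain ⟨hxz, hyz⟩ := hz
      obtain ⟨⟨hxz', hyz'⟩, hzb⟩ := hzbad
      have hxyF : s(x, y) ∉ F := heF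
      refine ⟨Q' ⊔ (SimpleGraph.edge x z ⊔ SimpleGraph.edge y z), ?_, ?_, ?_, ?_⟩
      · refine sup_le hQ' (sup_le ?_ ?_) <;> rw [SimpleGraph.edge_le_iff]
        · exact Or.inr hxz
        · exact Or.inr hyz
      · have h1 : SimpleGraph.fromEdgeSet (↑(insert s(x, y) F) : Set (Sym2 V)) ⊔
            (Q' ⊔ (SimpleGraph.edge x z ⊔ SimpleGraph.edge y z)) =
            (SimpleGraph.fromEdgeSet (F : Set (Sym2 V)) ⊔ Q') ⊔ triangleGraph x y z := by
          have hxy' := hE.ne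
          have hxz'' := hxz.ne
          have hyz'' := hyz.ne
          ext u v
          simp only [SimpleGraph.sup_adj, SimpleGraph.fromEdgeSet_adj, Finset.coe_insert,
            Set.mem_insert_iff, Finset.mem_coe, SimpleGraph.edge_adj, triangleGraph_adj,
            Sym2.eq_iff]
          grind
        rw [h1]
        refine hdec.sup (hasTriangleDecomposition_triangleGraph hE.ne hxz.ne hyz.ne) ?_
        intro u v huv
        rw [triangleGraph_adj]
        have hnF : ∀ u v, Q.Adj u v → ¬ s(u, v) ∈ F := fun u v h h' => hEQ u v (hFE _ h') h
        have hnQ : ¬ Q'.Adj x y := fun h => hEQ _ _ hE (hQ' h)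
        simp only [SimpleGraph.sup_adj, SimpleGraph.fromEdgeSet_adj, Finset.mem_coe] at huv
        have a1 := hnF _ _ hxz
        have a2 := hnF _ _ hyz
        have hsw : ∀ a b : V, s(a, b) = s(b, a) := fun a b => Sym2.eq_swap
        have hsy : ∀ a b : V, Q'.Adj a b → Q'.Adj b a := fun a b h => h.symm
        rintro ⟨hne, rfl | rfl | rfl, rfl | rfl | rfl⟩ <;> grind
      · intro v
        have h1 := degIn_sup_le Q' (SimpleGraph.edge x z ⊔ SimpleGraph.edge y z) v univ
        have h2 := degIn_sup_le (SimpleGraph.edge x z) (SimpleGraph.edge y z) v univ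
        have h3 := degIn_edge_le x z v
        have h4 := degIn_edge_le y z v
        have h5 : ((insert s(x, y) F).filter (v ∈ ·)).card =
            (F.filter (v ∈ ·)).card + if v = x ∨ v = y then 1 else 0 := by
          rw [Finset.filter_insert]
          split_ifs with h6 h7 h7
          · rw [Finset.card_insert_of_notMem (by simp [hxyF])]
          · simp at h6; tauto
          · simp at h6; tauto
          · simp
        have h6 := hdeg v
        have hxy' := hE.ne
        have hxz'' := hxz.ne
        have hyz'' := hyz.ne
        rw [h5]
        by_cases hvz : v = z
        · subst hvz
          simp only [hxz''.symm, hyz''.symm, if_false, if_true, or_self] at h3 h4 ⊢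
          omega
        · simp only [hvz, if_false] at h3 h4
          have h7 : ¬ (v = x ∧ v = y) := fun h => hxy' (h.1.symm.trans h.2)
          split_ifs at h3 h4 ⊢ <;> first | omega | tauto
      · have h1 : ∀ v, degIn (Q' ⊔ (SimpleGraph.edge x z ⊔ SimpleGraph.edge y z)) v univ ≤
            degIn Q' v univ + (((if v = x then 1 else 0) + if v = z then 1 else 0) +
              ((if v = y then 1 else 0) + if v = z then 1 else 0)) := fun v =>
          (degIn_sup_le _ _ _ _).trans (Nat.add_le_add_left ((degIn_sup_le _ _ _ _).trans
            (Nat.add_le_add (degIn_edge_le _ _ _) (degIn_edge_le _ _ _))) _)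
        refine (Finset.sum_le_sum fun v _ => h1 v).trans ?_
        rw [Finset.card_insert_of_notMem hxyF]
        simp only [Finset.sum_add_distrib, Finset.sum_ite_eq', Finset.mem_univ, if_true]
        omega
  obtain ⟨Q', hQ', hdec, hdeg, -⟩ := key (univ.filter (· ∈ E.edgeSet)) (by simp)
  refine ⟨Q', hQ', ?_, fun x => (hdeg x).trans (Nat.add_le_add_left
    ((card_filter_mem_le_degIn (by simp) x).trans (hd x)) _)⟩
  simpa using hdec

end GreedyCover

end

section

open Classical Finset

/-! ### Edge-disjoint perfect matchings -/

section DisjointMatchings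

variable {V P Λ : Type*}

/-- Perfect matchings of the sets `N x`, `x ∈ X`, that are pairwise edge-disjoint. Each `x` carries
a line `lam x` and each vertex a point `χ v`, all points of `N x` lie on `lam x`, and only edges
joining different points are used. Two points determine a line, so an edge can only be wanted by
vertices `x` with the same line; there are at most `k` of these, which Dirac's condition can
spare. -/
theorem exists_disjoint_matchings [Fintype V] (Γ : SimpleGraph V) (N : V → Finset V) (X : Finset V)
    (lam : V → Λ) (χ : V → P) (Inc : P → Λ → Prop) (k : ℕ)
    (hΓ : ∀ u v, Γ.Adj u v → χ u ≠ χ v)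
    (huniq : ∀ c c' ℓ ℓ', c ≠ c' → Inc c ℓ → Inc c' ℓ → Inc c ℓ' → Inc c' ℓ' → ℓ = ℓ')
    (hinc : ∀ x ∈ X, ∀ u ∈ N x, Inc (χ u) (lam x))
    (hk : ∀ ℓ, (X.filter fun x => lam x = ℓ).card ≤ k)
    (heven : ∀ x ∈ X, Even (N x).card)
    (hdeg : ∀ x ∈ X, ∀ u ∈ N x, (N x).card + 2 * k ≤ 2 * degIn Γ u (N x)) :
    ∃ m : V → V → V, ∀ x ∈ X, ∀ u ∈ N x, m x u ∈ N x ∧ m x (m x u) = u ∧ Γ.Adj u (m x u) ∧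
      ∀ x' ∈ X, x' ≠ x → u ∈ N x' → m x' u ≠ m x u := by
  have key : ∀ F ⊆ X, ∃ m : V → V → V, ∀ x ∈ F, ∀ u ∈ N x,
      m x u ∈ N x ∧ m x (m x u) = u ∧ Γ.Adj u (m x u) ∧
      ∀ x' ∈ F, x' ≠ x → u ∈ N x' → m x' u ≠ m x u := by
    intro F
    induction F using Finset.induction_on with
    | empty => exact fun _ => ⟨fun _ u => u, by simp⟩
    | insert x F hxF ih =>
      intro hF
      obtain ⟨m, hm⟩ := ih ((Finset.subset_insert _ _).trans hF)
      have hxX := hF (Finset.mem_insert_self _ _)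
      have hFX : ∀ y ∈ F, y ∈ X := fun y hy => hF (Finset.mem_insert_of_mem hy)
      -- the edges of `Γ` that are not used by the previous vertices with the same line
      obtain ⟨Γx, hΓx⟩ : ∃ Γx : SimpleGraph V, ∀ u v, Γx.Adj u v ↔
          Γ.Adj u v ∧ ∀ y ∈ F, lam y = lam x → u ∈ N y → m y u ≠ v :=
        ⟨{ Adj := fun u v => Γ.Adj u v ∧ ∀ y ∈ F, lam y = lam x → u ∈ N y → m y u ≠ v
           symm := ⟨fun u v ⟨h, h'⟩ => ⟨h.symm, fun y hy hyx hv hmv => by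
             obtain ⟨h1, h2, -⟩ := hm y hy v hv
             rw [hmv] at h1 h2
             exact h' y hy hyx h1 h2⟩⟩
           loopless := ⟨fun u h => h.1.ne rfl⟩ }, fun _ _ => Iff.rfl⟩
      have hdegx : ∀ u ∈ N x, (N x).card ≤ 2 * degIn Γx u (N x) := by
        intro u hu
        have h1 : degIn Γ u (N x) ≤ degIn Γx u (N x) + k := by
          have h2 : (N x).filter (Γ.Adj u) ⊆ (N x).filter (Γx.Adj u) ∪
              (X.filter fun y => lam y = lam x).image fun y => m y u := by
            intro v hv
            rw [Finset.mem_filter] at hv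
            by_cases h3 : Γx.Adj u v
            · exact Finset.mem_union_left _ (Finset.mem_filter.2 ⟨hv.1, h3⟩)
            · have h4 : ∃ y ∈ F, lam y = lam x ∧ u ∈ N y ∧ m y u = v := by
                by_contra h5
                push Not at h5
                exact h3 ((hΓx _ _).2 ⟨hv.2, h5⟩)
              obtain ⟨y, hy, hyx, -, hyv⟩ := h4
              exact Finset.mem_union_right _ (Finset.mem_image.2
                ⟨y, Finset.mem_filter.2 ⟨hFX y hy, hyx⟩, hyv⟩)
          have h3 := (Finset.card_le_card h2).trans (Finset.card_union_le _ _)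
          have h4 : ((X.filter fun y => lam y = lam x).image fun y => m y u).card ≤ k :=
            Finset.card_image_le.trans (hk _)
          exact h3.trans (Nat.add_le_add_left h4 _)
        have h2 := hdeg x hxX u hu
        omega
      obtain ⟨mx, hmx⟩ := exists_perfectMatching (heven x hxX) hdegx
      have hcross : ∀ y ∈ F, ∀ u ∈ N x, u ∈ N y → m y u ≠ mx u := by
        intro y hy u hux huy h
        obtain ⟨h1, -, h2⟩ := hmx u hux
        rw [hΓx] at h2
        obtain ⟨h3, -, h4, -⟩ := hm y hy u huy
        refine h2.2 y hy ?_ huy h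
        rw [h] at h3
        exact huniq (χ u) (χ (mx u)) _ _ (hΓ _ _ h2.1) (hinc y (hFX y hy) u huy)
          (hinc y (hFX y hy) _ h3) (hinc x hxX u hux) (hinc x hxX _ h1)
      refine ⟨Function.update m x mx, fun y hy u hu => ?_⟩
      by_cases hyx : y = x
      · subst hyx
        rw [Function.update_self]
        refine ⟨(hmx u hu).1, (hmx u hu).2.1, ((hΓx _ _).1 (hmx u hu).2.2).1, fun z hz hzy huz => ?_⟩
        rw [Function.update_of_ne hzy]
        exact hcross z ((Finset.mem_insert.1 hz).resolve_left hzy) u hu huz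
      · have hyF := (Finset.mem_insert.1 hy).resolve_left hyx
        rw [Function.update_of_ne hyx]
        obtain ⟨h1, h2, h3, h4⟩ := hm y hyF u hu
        refine ⟨h1, h2, h3, fun z hz hzy huz => ?_⟩
        by_cases hzx : z = x
        · subst hzx
          rw [Function.update_self]
          exact (hcross y hyF u huz hu).symm
        · rw [Function.update_of_ne hzx]
          exact h4 z ((Finset.mem_insert.1 hz).resolve_left hzx) hzy huz
  exact key X subset_rfl

/-- The union over `x ∈ X` of all triangles `x`, `u`, `m x u` with `u ∈ N x`. -/
def matchingStars (N : V → Finset V) (X : Finset V) (m : V → V → V) : SimpleGraph V :=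
  SimpleGraph.fromRel fun a b => a ∈ X ∧ b ∈ N a ∨ ∃ x ∈ X, a ∈ N x ∧ m x a = b

theorem matchingStars_adj {N : V → Finset V} {X : Finset V} {m : V → V → V}
    (hN : ∀ x ∈ X, ∀ u ∈ N x, u ∉ X)
    (hm : ∀ x ∈ X, ∀ u ∈ N x, m x u ∈ N x ∧ m x (m x u) = u ∧ m x u ≠ u) (a b : V) :
    (matchingStars N X m).Adj a b ↔
      (a ∈ X ∧ b ∈ N a) ∨ (b ∈ X ∧ a ∈ N b) ∨ ∃ x ∈ X, a ∈ N x ∧ m x a = b := by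
  rw [matchingStars, SimpleGraph.fromRel_adj]
  constructor
  · rintro ⟨-, (h | h) | h | ⟨x, hx, hb, rfl⟩⟩
    · exact Or.inl h
    · exact Or.inr (Or.inr h)
    · exact Or.inr (Or.inl h)
    · exact Or.inr (Or.inr ⟨x, hx, (hm x hx b hb).1, (hm x hx b hb).2.1⟩)
  · rintro (h | h | ⟨x, hx, ha, rfl⟩)
    · exact ⟨fun hab => hN a h.1 b h.2 (hab ▸ h.1), Or.inl (Or.inl h)⟩
    · exact ⟨fun hab => hN b h.1 a h.2 (hab ▸ h.1), Or.inr (Or.inl h)⟩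
    · exact ⟨(hm x hx a ha).2.2.symm, Or.inl (Or.inr ⟨x, hx, ha, rfl⟩)⟩

theorem hasTriangleDecomposition_matchingStars {N : V → Finset V} {X : Finset V}
    {m : V → V → V} (hN : ∀ x ∈ X, ∀ u ∈ N x, u ∉ X)
    (hm : ∀ x ∈ X, ∀ u ∈ N x, m x u ∈ N x ∧ m x (m x u) = u ∧ m x u ≠ u)
    (hdisj : ∀ x ∈ X, ∀ u ∈ N x, ∀ x' ∈ X, x' ≠ x → u ∈ N x' → m x' u ≠ m x u) :
    HasTriangleDecomposition (matchingStars N X m) := by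
  let t : V → V → V := fun a b => if a ∈ X then m a b else if b ∈ X then m b a else
    if h : ∃ x ∈ X, a ∈ N x ∧ m x a = b then h.choose else a
  have ht : ∀ x ∈ X, ∀ u ∈ N x, t x u = m x u ∧ t u x = m x u ∧ t u (m x u) = x := by
    intro x hx u hu
    have hux := hN x hx u hu
    have hmx := hN x hx _ (hm x hx u hu).1
    have h : ∃ y ∈ X, u ∈ N y ∧ m y u = m x u := ⟨x, hx, hu, rfl⟩
    refine ⟨by simp [t, hx], by simp [t, hx, hux], ?_⟩
    simp only [t, hux, hmx, if_false, dif_pos h]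
    by_contra hne
    exact hdisj x hx u hu _ h.choose_spec.1 hne h.choose_spec.2.1 h.choose_spec.2.2
  refine hasTriangleDecomposition_of_third t ?_ ?_ ?_
  all_goals
    intro a b hab
    simp only [matchingStars_adj hN hm] at hab ⊢
    rcases hab with ⟨ha, hb⟩ | ⟨hb, ha⟩ | ⟨x, hx, ha, rfl⟩
  · rw [(ht a ha b hb).1, (ht a ha b hb).2.1]
  · rw [(ht b hb a ha).1, (ht b hb a ha).2.1]
  · have h1 := (ht x hx _ (hm x hx a ha).1).2.2
    rw [(hm x hx a ha).2.1] at h1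
    rw [(ht x hx a ha).2.2, h1]
  · rw [(ht a ha b hb).1]
    exact Or.inl ⟨ha, (hm a ha b hb).1⟩
  · rw [(ht b hb a ha).2.1]
    exact Or.inr (Or.inr ⟨b, hb, ha, rfl⟩)
  · rw [(ht x hx a ha).2.2]
    exact Or.inr (Or.inl ⟨hx, ha⟩)
  · rw [(ht a ha b hb).1, (ht a ha _ (hm a ha b hb).1).1, (hm a ha b hb).2.1]
  · rw [(ht b hb a ha).2.1, (ht b hb a ha).2.2]
  · rw [(ht x hx a ha).2.2, (ht x hx a ha).2.1]

end DisjointMatchings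

end

section

open Classical Finset

/-! ### Covering the edges outside a vertex set -/

section CoverDown

variable {V P Λ : Type*}

theorem card_filter_inc_eq_sum [Fintype P] (S : Finset V) (χ : V → P) (p : P → Prop) :
    (S.filter fun v => p (χ v)).card = ∑ c ∈ univ.filter p, (S.filter fun v => χ v = c).card := by
  rw [Finset.card_eq_sum_card_fiberwise (f := χ) (t := univ.filter p) (by intro v; simp)]
  refine Finset.sum_congr rfl fun c hc => ?_
  rw [Finset.filter_filter]
  congr 1
  ext v
  simp only [Finset.mem_filter, Finset.mem_univ, true_and] at hc ⊢
  constructor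
  · exact fun h => ⟨h.1, h.2.2⟩
  · rintro ⟨h, rfl⟩
    exact ⟨h, hc, rfl⟩

set_option maxHeartbeats 2000000 in
/-- The covering step for a graph `G` and a vertex set `U`: all edges not inside `U` can be covered
by edge-disjoint triangles that use few edges at each vertex inside `U`. The vertices carry points
`χ v` and lines `lam v` of a projective plane. The edges between `x ∉ U` and those `u ∈ U` whose
point lies on the line of `x` are set aside, the remaining edges outside `U` are decomposed
approximately, the leftover is covered greedily with the help of the reserved edges, and the
reserved edges still uncovered at `x` are completed to triangles by a perfect matching of their
ends in `U`. -/
theorem exists_cover_of_plane [Fintype V] [Fintype P] [Fintype Λ] (G : SimpleGraph V)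
    (U : Finset V) (Inc : P → Λ → Prop) (χ : V → P) (lam : V → Λ) (r b d s : ℕ)
    {δ ε κ γ η p θ τ μ : ℝ} (hη : 0 ≤ η) (hp : 0 < p)
    (hmeet : ∀ ℓ ℓ', ∃ c, Inc c ℓ ∧ Inc c ℓ')
    (huniq : ∀ c c' ℓ ℓ', c ≠ c' → Inc c ℓ → Inc c' ℓ → Inc c ℓ' → Inc c' ℓ' → ℓ = ℓ')
    (hline : ∀ ℓ, (univ.filter fun c => Inc c ℓ).card = r + 1)
    (hpoint : ∀ c, (univ.filter fun ℓ => Inc c ℓ).card = r + 1)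
    (hχ : ∀ x y c,
      |(((U.filter fun v => G.Adj x v ∧ G.Adj y v).filter fun v => χ v = c).card : ℝ) -
        (U.filter fun v => G.Adj x v ∧ G.Adj y v).card / p| ≤ η * Fintype.card V)
    (hχU : ∀ c, ((U.filter fun v => χ v = c).card : ℝ) ≤ U.card / p + η * Fintype.card V)
    (hlam : ∀ ℓ, ((univ.filter fun v => lam v = ℓ).card : ℝ) ≤
      Fintype.card V / p + η * Fintype.card V)
    (hU : κ * Fintype.card V ≤ U.card) (hU' : U.card ≤ ε * Fintype.card V)
    (hdeg : ∀ x, (δ + 2 * ε) * Fintype.card V ≤ degIn G x univ)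
    (hdegU : ∀ x, 3 / 4 * (U.card : ℝ) ≤ degIn G x U)
    (heven : ∀ x, x ∉ U → Even (degIn G x univ))
    (happ : ∀ G' : SimpleGraph V, (∀ x, δ * Fintype.card V ≤ degIn G' x univ) →
      ∃ H ≤ G', HasTriangleDecomposition H ∧
        ∀ x, (degIn (G' \ H) x univ : ℝ) ≤ γ * Fintype.card V)
    (hτ : (r + 1) * (1 / p + η) ≤ τ) (hτε : τ ≤ ε) (hτμ : θ + τ ≤ μ)
    (hd : γ * Fintype.card V < d + 1)
    (hs : (s : ℝ) ≤ κ / (2 * p) * Fintype.card V - η * Fintype.card V)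
    (hθ : (b : ℝ) + 2 + d ≤ θ * Fintype.card V)
    (hlt : 2 * (b + 2 + d) * (b + 1) + 2 * (Fintype.card V * d) < s * (b + 1))
    (hDirac : ∀ D D' : ℝ, 3 / 4 * (U.card : ℝ) ≤ D → D - U.card / 4 ≤ D' →
      (r + 1) * (D / p + η * Fintype.card V) +
        2 * (Fintype.card V / p + η * Fintype.card V) ≤
      2 * ((r + 1) * (D' / p - η * Fintype.card V) - 2 * (θ * Fintype.card V) -
        (U.card / p + η * Fintype.card V))) :
    ∃ H ≤ G, HasTriangleDecomposition H ∧
      (∀ x y, G.Adj x y → ¬ (x ∈ U ∧ y ∈ U) → H.Adj x y) ∧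
      ∀ x, x ∈ U → (degIn H x U : ℝ) ≤ μ * Fintype.card V := by
  set n : ℝ := (Fintype.card V : ℝ) with hn
  have hn0 : 0 ≤ n := Nat.cast_nonneg _
  -- the reserved edges, and the edges inside `U`
  obtain ⟨R, hR⟩ : ∃ R : SimpleGraph V, ∀ x y, R.Adj x y ↔ G.Adj x y ∧
      ((x ∉ U ∧ y ∈ U ∧ Inc (χ y) (lam x)) ∨ (y ∉ U ∧ x ∈ U ∧ Inc (χ x) (lam y))) :=
    ⟨{ Adj := fun x y => G.Adj x y ∧
        ((x ∉ U ∧ y ∈ U ∧ Inc (χ y) (lam x)) ∨ (y ∉ U ∧ x ∈ U ∧ Inc (χ x) (lam y)))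
       symm := ⟨fun x y h => ⟨h.1.symm, h.2.symm⟩⟩
       loopless := ⟨fun x h => h.1.ne rfl⟩ }, fun _ _ => Iff.rfl⟩
  obtain ⟨I, hI⟩ : ∃ I : SimpleGraph V, ∀ x y, I.Adj x y ↔ G.Adj x y ∧ x ∈ U ∧ y ∈ U :=
    ⟨{ Adj := fun x y => G.Adj x y ∧ x ∈ U ∧ y ∈ U
       symm := ⟨fun x y h => ⟨h.1.symm, h.2.2, h.2.1⟩⟩
       loopless := ⟨fun x h => h.1.ne rfl⟩ }, fun _ _ => Iff.rfl⟩
  obtain ⟨Q, hQRI⟩ : ∃ Q, Q = R ⊔ I := ⟨_, rfl⟩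
  have hQ : ∀ a b, Q.Adj a b ↔ R.Adj a b ∨ I.Adj a b := fun a b => by
    rw [hQRI, SimpleGraph.sup_adj]
  have hQG : ∀ a b, Q.Adj a b → G.Adj a b := by
    intro a b
    rw [hQ, hR, hI]
    tauto
  have hdegR : ∀ u ∈ U, (degIn R u univ : ℝ) ≤ τ * n := by
    intro u hu
    have h1 : univ.filter (R.Adj u) ⊆ univ.filter fun x => Inc (χ u) (lam x) := by
      intro x
      simp only [Finset.mem_filter, Finset.mem_univ, true_and, hR]
      tauto
    have h2 := Finset.card_le_card h1
    rw [card_filter_inc_eq_sum univ lam (Inc (χ u))] at h2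
    -- the point of `u` lies on `r + 1` lines, each of which belongs to few vertices
    calc (degIn R u univ : ℝ) ≤
        ∑ ℓ ∈ univ.filter (Inc (χ u)), ((univ.filter fun v => lam v = ℓ).card : ℝ) := by
          exact_mod_cast h2
      _ ≤ ∑ ℓ ∈ univ.filter (Inc (χ u)), (n / p + η * n) := Finset.sum_le_sum fun ℓ _ => hlam ℓ
      _ = (r + 1) * (1 / p + η) * n := by
          rw [Finset.sum_const, hpoint, nsmul_eq_mul]
          push_cast
          ring
      _ ≤ τ * n := mul_le_mul_of_nonneg_right hτ hn0
  -- the approximate decomposition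
  have hG' : ∀ x, δ * n ≤ degIn (G \ Q) x univ := by
    intro x
    have h1 : degIn G x univ ≤ degIn (G \ Q) x univ + degIn Q x univ := by
      refine le_trans (degIn_mono ?_ x subset_rfl) (degIn_sup_le _ _ _ _)
      rw [sdiff_sup_self]
      exact le_sup_left
    have h2 : (degIn Q x univ : ℝ) ≤ 2 * (ε * n) := by
      by_cases hx : x ∈ U
      · have h3 := hQRI ▸ degIn_sup_le R I x univ
        have h4 : degIn I x univ ≤ U.card := by
          refine Finset.card_le_card fun y => ?_
          simp only [Finset.mem_filter, Finset.mem_univ, true_and, hI]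
          tauto
        have h5 := hdegR x hx
        have h6 : τ * n ≤ ε * n := mul_le_mul_of_nonneg_right hτε hn0
        have h7 : (degIn Q x univ : ℝ) ≤ degIn R x univ + degIn I x univ := by
          exact_mod_cast h3
        have h8 : (degIn I x univ : ℝ) ≤ U.card := by exact_mod_cast h4
        linarith
      · have h4 : degIn Q x univ ≤ U.card := by
          refine Finset.card_le_card fun y => ?_
          simp only [Finset.mem_filter, Finset.mem_univ, true_and, hI, hR, hQ]
          tauto
        have h8 : (degIn Q x univ : ℝ) ≤ U.card := by exact_mod_cast h4
        linarith [(Nat.cast_nonneg U.card : (0 : ℝ) ≤ U.card)]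
    have h3 : (degIn G x univ : ℝ) ≤
        degIn (G \ Q) x univ + degIn Q x univ := by exact_mod_cast h1
    linarith [hdeg x]
  obtain ⟨H₁, hH₁, hH₁dec, hH₁deg⟩ := happ _ hG'
  obtain ⟨E, hEeq⟩ : ∃ E, E = (G \ Q) \ H₁ := ⟨_, rfl⟩
  rw [← hEeq] at hH₁deg
  have hE : ∀ a b, E.Adj a b ↔ (G.Adj a b ∧ ¬ Q.Adj a b) ∧ ¬ H₁.Adj a b := fun a b => by
    rw [hEeq]
    rfl
  have hH₁adj : ∀ a b, H₁.Adj a b → G.Adj a b ∧ ¬ Q.Adj a b := fun a b h => hH₁ h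
  -- counting common neighbours in `U` with a given point, or with a point on a given line
  have hcom : ∀ x y, (degIn G x U : ℝ) - U.card / 4 ≤
      (U.filter fun v => G.Adj x v ∧ G.Adj y v).card := by
    intro x y
    have h1 := Finset.card_inter_add_card_union (U.filter (G.Adj x)) (U.filter (G.Adj y))
    have h2 : (U.filter (G.Adj x) ∪ U.filter (G.Adj y)).card ≤ U.card :=
      Finset.card_le_card (Finset.union_subset (Finset.filter_subset _ _)
        (Finset.filter_subset _ _))
    rw [← Finset.filter_and] at h1
    have h3 : (degIn G x U : ℝ) + degIn G y U ≤
        (U.filter fun v => G.Adj x v ∧ G.Adj y v).card + U.card := by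
      unfold degIn
      exact_mod_cast h1.symm.le.trans (Nat.add_le_add_left h2 _)
    linarith [hdegU y]
  have hcomc : ∀ x y c, s ≤
      ((U.filter fun v => G.Adj x v ∧ G.Adj y v).filter fun v => χ v = c).card := by
    intro x y c
    have h1 := (abs_le.1 (hχ x y c)).1
    have h2 := hcom x y
    have h3 := hdegU x
    have h4 : κ / (2 * p) * n ≤
        ((U.filter fun v => G.Adj x v ∧ G.Adj y v).card : ℝ) / p := by
      rw [le_div_iff₀ hp, show κ / (2 * p) * n * p = κ * n / 2 by field_simp]
      linarith
    have h5 : (s : ℝ) ≤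
        (((U.filter fun v => G.Adj x v ∧ G.Adj y v).filter fun v => χ v = c).card : ℝ) := by
      linarith
    exact_mod_cast h5
  have hsum : ∀ x y ℓ,
      |(((U.filter fun v => G.Adj x v ∧ G.Adj y v).filter fun v => Inc (χ v) ℓ).card : ℝ) -
        (r + 1) * ((U.filter fun v => G.Adj x v ∧ G.Adj y v).card / p)| ≤
          (r + 1) * (η * n) := by
    intro x y ℓ
    set A := U.filter fun v => G.Adj x v ∧ G.Adj y v with hA
    rw [card_filter_inc_eq_sum A χ (fun c => Inc c ℓ)]
    have h1 : ((r : ℝ) + 1) * ((A.card : ℝ) / p) =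
        ∑ _c ∈ univ.filter fun c => Inc c ℓ, (A.card : ℝ) / p := by
      rw [Finset.sum_const, hline, nsmul_eq_mul]
      push_cast
      ring
    have h2 : ((r : ℝ) + 1) * (η * n) = ∑ _c ∈ univ.filter fun c => Inc c ℓ, η * n := by
      rw [Finset.sum_const, hline, nsmul_eq_mul]
      push_cast
      ring
    rw [h1, h2]
    push_cast
    rw [← Finset.sum_sub_distrib]
    exact (Finset.abs_sum_le_sum_abs _ _).trans (Finset.sum_le_sum fun c _ => hχ x y c)
  -- the greedy cover of the leftover
  have hEQ : ∀ x y, E.Adj x y → ¬ Q.Adj x y := fun x y h => ((hE x y).1 h).1.2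
  have hEd : ∀ x, degIn E x univ ≤ d := by
    intro x
    have h1 := hH₁deg x
    have h2 : (degIn E x univ : ℝ) < (d + 1 : ℕ) := by
      push_cast
      exact h1.trans_lt hd
    exact Nat.lt_succ_iff.1 (by exact_mod_cast h2)
  have hEs : ∀ x y, E.Adj x y → s ≤ (univ.filter fun z => Q.Adj x z ∧ Q.Adj y z).card := by
    have h1 : ∀ x y, x ∉ U → E.Adj x y →
        s ≤ (univ.filter fun z => Q.Adj x z ∧ Q.Adj y z).card := by
      intro x y hx hxy
      by_cases hy : y ∈ U
      · obtain ⟨c, hc, -⟩ := hmeet (lam x) (lam x)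
        refine (hcomc x y c).trans (Finset.card_le_card fun z => ?_)
        simp only [Finset.mem_filter, Finset.mem_univ, true_and, hQ, hR, hI]
        rintro ⟨⟨hzU, hxz, hyz⟩, rfl⟩
        exact ⟨Or.inl ⟨hxz, Or.inl ⟨hx, hzU, hc⟩⟩, Or.inr ⟨hyz, hy, hzU⟩⟩
      · obtain ⟨c, hc, hc'⟩ := hmeet (lam x) (lam y)
        refine (hcomc x y c).trans (Finset.card_le_card fun z => ?_)
        simp only [Finset.mem_filter, Finset.mem_univ, true_and, hQ, hR, hI]
        rintro ⟨⟨hzU, hxz, hyz⟩, rfl⟩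
        exact ⟨Or.inl ⟨hxz, Or.inl ⟨hx, hzU, hc⟩⟩, Or.inl ⟨hyz, Or.inl ⟨hy, hzU, hc'⟩⟩⟩
    intro x y hxy
    by_cases hx : x ∈ U
    · have hy : y ∉ U := by
        intro hy
        have := hEQ x y hxy
        rw [hQ, hI] at this
        have := ((hE x y).1 hxy).1.1
        tauto
      refine (h1 y x hy hxy.symm).trans (le_of_eq ?_)
      congr 1
      ext z
      simp [and_comm]
    · exact h1 x y hx hxy
  obtain ⟨Q', hQ'Q, hEdec, hQ'deg⟩ := exists_greedy_cover E Q hEQ d b s hEd hEs hlt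
  have hQ'θ : ∀ x, (degIn Q' x univ : ℝ) ≤ θ * n := by
    intro x
    refine le_trans ?_ hθ
    exact_mod_cast hQ'deg x
  -- the ends of the reserved edges that remain to be covered
  obtain ⟨N, hN⟩ : ∃ N : V → Finset V, ∀ x, N x = U.filter fun u => R.Adj x u ∧ ¬ Q'.Adj x u :=
    ⟨_, fun _ => rfl⟩
  obtain ⟨X, hX⟩ : ∃ X : Finset V, X = univ \ U := ⟨_, rfl⟩
  have hXmem : ∀ x, x ∈ X ↔ x ∉ U := by simp [hX]
  have hNmem : ∀ x, x ∉ U → ∀ u, u ∈ N x ↔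
      u ∈ U ∧ G.Adj x u ∧ Inc (χ u) (lam x) ∧ ¬ Q'.Adj x u := by
    intro x hx u
    simp only [hN, Finset.mem_filter, hR]
    tauto
  have hNeven : ∀ x ∈ X, Even (N x).card := by
    intro x hx
    rw [hXmem] at hx
    have hQ'Q' : ∀ a b, Q'.Adj a b → Q.Adj a b := fun a b h => hQ'Q h
    have h1 : G = (H₁ ⊔ (E ⊔ Q')) ⊔ (Q \ Q') := by
      ext a b
      have h1 := hQ'Q' a b
      have h2 := hH₁adj a b
      have h3 := hQG a b
      have h4 := hE a b
      simp only [SimpleGraph.sup_adj, SimpleGraph.sdiff_adj]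
      tauto
    have h2 : degIn (Q \ Q') x univ = (N x).card := by
      unfold degIn
      congr 1
      ext u
      simp only [Finset.mem_filter, Finset.mem_univ, true_and, SimpleGraph.sdiff_adj, hQ, hI, hN,
        hR]
      tauto
    have h3 : degIn G x univ = degIn H₁ x univ + degIn (E ⊔ Q') x univ + (N x).card := by
      rw [← h2]
      conv_lhs => rw [h1]
      rw [SimpleGraph.degIn_sup_of_disjoint, SimpleGraph.degIn_sup_of_disjoint]
      all_goals
        intro a b h
        have h1 := hQ'Q' a b
        have h2 := hH₁adj a b
        have h4 := hE a b
        simp only [SimpleGraph.sup_adj, SimpleGraph.sdiff_adj] at h ⊢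
        tauto
    have h4 := heven x hx
    rw [h3] at h4
    exact (Nat.even_add.1 h4).1 ((hH₁dec.divisible.1 x).add (hEdec.divisible.1 x))
  obtain ⟨Γ, hΓ⟩ : ∃ Γ : SimpleGraph V, ∀ u v, Γ.Adj u v ↔ I.Adj u v ∧ χ u ≠ χ v ∧ ¬ Q'.Adj u v :=
    ⟨{ Adj := fun u v => I.Adj u v ∧ χ u ≠ χ v ∧ ¬ Q'.Adj u v
       symm := ⟨fun u v h => ⟨h.1.symm, h.2.1.symm, fun h' => h.2.2 h'.symm⟩⟩
       loopless := ⟨fun u h => h.1.ne rfl⟩ }, fun _ _ => Iff.rfl⟩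
  have hk0 : 0 ≤ n / p + η * n := by positivity
  obtain ⟨m, hm⟩ := exists_disjoint_matchings Γ N X lam χ Inc ⌊n / p + η * n⌋₊
    (fun u v h => ((hΓ u v).1 h).2.1) huniq
    (fun x hx u hu => ((hNmem x ((hXmem x).1 hx) u).1 hu).2.2.1)
    (fun ℓ => by
      refine Nat.le_floor (le_trans ?_ (hlam ℓ))
      exact_mod_cast Finset.card_le_card (Finset.filter_subset_filter _ (Finset.subset_univ X)))
    hNeven (by
      intro x hx u hu
      have hxU := (hXmem x).1 hx
      have huU := ((hNmem x hxU u).1 hu).1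
      have hself : (U.filter fun v => G.Adj x v ∧ G.Adj x v) = U.filter (G.Adj x) := by simp
      have h1 : ((N x).card : ℝ) ≤ (r + 1) * ((degIn G x U : ℝ) / p + η * n) := by
        have h2 := (abs_le.1 (hsum x x (lam x))).2
        have h3 : (N x).card ≤
            ((U.filter fun v => G.Adj x v ∧ G.Adj x v).filter fun v => Inc (χ v) (lam x)).card := by
          refine Finset.card_le_card fun v hv => ?_
          have := (hNmem x hxU v).1 hv
          simp only [Finset.mem_filter]
          tauto
        have h4 : ((N x).card : ℝ) ≤
            (((U.filter fun v => G.Adj x v ∧ G.Adj x v).filter fun v =>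
              Inc (χ v) (lam x)).card : ℝ) := by exact_mod_cast h3
        rw [hself] at h2 h4
        unfold degIn
        linarith
      have h2 := (abs_le.1 (hsum x u (lam x))).1
      have h3 : ((U.filter fun v => G.Adj x v ∧ G.Adj u v).filter fun v =>
          Inc (χ v) (lam x)) ⊆ (((N x).filter (Γ.Adj u) ∪ univ.filter (Q'.Adj x)) ∪
            univ.filter (Q'.Adj u)) ∪ U.filter fun v => χ v = χ u := by
        intro v hv
        simp only [Finset.mem_filter] at hv
        simp only [Finset.mem_union, Finset.mem_filter, Finset.mem_univ, true_and, hΓ, hI,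
          hNmem x hxU]
        have := @eq_comm _ (χ u) (χ v)
        tauto
      have h4 := (Finset.card_le_card h3).trans ((Finset.card_union_le _ _).trans
        (Nat.add_le_add_right ((Finset.card_union_le _ _).trans
          (Nat.add_le_add_right (Finset.card_union_le _ _) _)) _))
      have h5 : (((U.filter fun v => G.Adj x v ∧ G.Adj u v).filter fun v =>
          Inc (χ v) (lam x)).card : ℝ) ≤ degIn Γ u (N x) + degIn Q' x univ + degIn Q' u univ +
            (U.filter fun v => χ v = χ u).card := by
        unfold degIn
        exact_mod_cast h4
      have h6 := hDirac _ _ (hdegU x) (hcom x u)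
      have h7 := hχU (χ u)
      have h8 := hQ'θ x
      have h9 := hQ'θ u
      have h10 := Nat.floor_le hk0
      have h11 : ((N x).card : ℝ) + 2 * (⌊n / p + η * n⌋₊ : ℝ) ≤ 2 * (degIn Γ u (N x) : ℝ) := by
        linarith
      exact_mod_cast h11)
  have hNX : ∀ x ∈ X, ∀ u ∈ N x, u ∉ X := by
    intro x hx u hu
    rw [hXmem] at hx ⊢
    exact not_not.2 ((hNmem x hx u).1 hu).1
  have hm' : ∀ x ∈ X, ∀ u ∈ N x, m x u ∈ N x ∧ m x (m x u) = u ∧ m x u ≠ u :=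
    fun x hx u hu => ⟨(hm x hx u hu).1, (hm x hx u hu).2.1, (hm x hx u hu).2.2.1.ne'⟩
  have hH₃dec := hasTriangleDecomposition_matchingStars hNX hm'
    fun x hx u hu => (hm x hx u hu).2.2.2
  have hH₃adj := matchingStars_adj hNX hm'
  generalize matchingStars N X m = H₃ at hH₃dec hH₃adj
  have hH₃Q : ∀ x y, H₃.Adj x y → Q.Adj x y ∧ ¬ Q'.Adj x y := by
    have h1 : ∀ x ∈ X, ∀ u ∈ N x, Q.Adj x u ∧ ¬ Q'.Adj x u := by
      intro x hx u hu
      simp only [hN, Finset.mem_filter] at hu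
      exact ⟨(hQ _ _).2 (Or.inl hu.2.1), hu.2.2⟩
    intro x y hxy
    rcases (hH₃adj x y).1 hxy with ⟨hx, hy⟩ | ⟨hy, hx⟩ | ⟨z, hz, hx, rfl⟩
    · exact h1 x hx y hy
    · exact ⟨(h1 y hy x hx).1.symm, fun h => (h1 y hy x hx).2 h.symm⟩
    · have h2 := (hΓ _ _).1 (hm z hz x hx).2.2.1
      exact ⟨(hQ _ _).2 (Or.inr h2.1), h2.2.2⟩
  refine ⟨(H₁ ⊔ (E ⊔ Q')) ⊔ H₃, ?_, ?_, ?_, ?_⟩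
  · intro a b
    have h1 := hH₁adj a b
    have h2 := hE a b
    have h3 := hQG a b
    have h4 := @hQ'Q a b
    have h5 := hH₃Q a b
    simp only [SimpleGraph.sup_adj]
    tauto
  · refine (hH₁dec.sup hEdec ?_).sup hH₃dec ?_
    · intro a b h
      have h1 := hH₁adj a b h
      have h2 := hE a b
      have h4 := @hQ'Q a b
      simp only [SimpleGraph.sup_adj]
      tauto
    · intro a b h
      have h1 := hH₁adj a b
      have h2 := hE a b
      have h5 := hH₃Q a b
      simp only [SimpleGraph.sup_adj] at h
      tauto
  · intro x y hxy hU2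
    have h1 := hH₁adj x y
    have h2 := hE x y
    by_cases hQxy : Q.Adj x y
    · by_cases hQ'xy : Q'.Adj x y
      · exact Or.inl (Or.inr (Or.inr hQ'xy))
      · refine Or.inr ((hH₃adj x y).2 ?_)
        rw [hQ, hI] at hQxy
        have hRxy : R.Adj x y := by tauto
        have hQ'yx : ¬ Q'.Adj y x := fun h => hQ'xy h.symm
        rcases ((hR x y).1 hRxy).2 with h3 | h3
        · refine Or.inl ⟨(hXmem x).2 h3.1, ?_⟩
          simp only [hN, Finset.mem_filter]
          exact ⟨h3.2.1, hRxy, hQ'xy⟩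
        · refine Or.inr (Or.inl ⟨(hXmem y).2 h3.1, ?_⟩)
          simp only [hN, Finset.mem_filter]
          exact ⟨h3.2.1, hRxy.symm, hQ'yx⟩
    · simp only [SimpleGraph.sup_adj]
      tauto
  · intro x hx
    have h2 : degIn ((H₁ ⊔ (E ⊔ Q')) ⊔ H₃) x U ≤ degIn Q' x univ + degIn R x univ := by
      refine (Finset.card_le_card (t := univ.filter (Q'.Adj x) ∪
        (univ.filter (R.Adj x)).image fun z => m z x) ?_).trans
          ((Finset.card_union_le _ _).trans (Nat.add_le_add_left Finset.card_image_le _))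
      intro y hy
      simp only [Finset.mem_filter, SimpleGraph.sup_adj] at hy
      have hIxy : G.Adj x y → Q.Adj x y := fun h =>
        (hQ x y).2 (Or.inr ((hI x y).2 ⟨h, hx, hy.1⟩))
      have h2 := hH₁adj x y
      have h3 := hE x y
      have h4 : Q'.Adj x y ∨ H₃.Adj x y := by tauto
      rcases h4 with h4 | h4
      · exact Finset.mem_union_left _ (by simpa using h4)
      · refine Finset.mem_union_right _ ?_
        rcases (hH₃adj x y).1 h4 with ⟨h5, -⟩ | ⟨h5, -⟩ | ⟨z, hz, hxz, rfl⟩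
        · exact absurd hx ((hXmem x).1 h5)
        · exact absurd hy.1 ((hXmem y).1 h5)
        · simp only [hN, Finset.mem_filter] at hxz
          exact Finset.mem_image_of_mem _ (by simpa using hxz.2.1.symm)
    have h3 : (degIn ((H₁ ⊔ (E ⊔ Q')) ⊔ H₃) x U : ℝ) ≤ degIn Q' x univ + degIn R x univ := by
      exact_mod_cast h2
    have h4 := hQ'θ x
    have h5 := hdegR x hx
    have h6 : (θ + τ) * n ≤ μ * n := mul_le_mul_of_nonneg_right hτμ hn0
    linarith

end CoverDown

end

section

open Classical Finset

/-! ### Finite projective planes -/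

section Plane

open Configuration Configuration.ofField in
open scoped LinearAlgebra.Projectivization in
/-- There are finite projective planes of arbitrarily large order `r`, given here by the incidence
relation between points and lines. -/
theorem exists_projectivePlane (r₀ : ℕ) :
    ∃ (r : ℕ) (P Λ : Type) (_ : Fintype P) (_ : Fintype Λ) (Inc : P → Λ → Prop), r₀ ≤ r ∧
      Fintype.card P = r ^ 2 + r + 1 ∧ Fintype.card Λ = r ^ 2 + r + 1 ∧
      (∀ ℓ ℓ', ∃ c, Inc c ℓ ∧ Inc c ℓ') ∧
      (∀ c c' ℓ ℓ', c ≠ c' → Inc c ℓ → Inc c' ℓ → Inc c ℓ' → Inc c' ℓ' → ℓ = ℓ') ∧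
      (∀ ℓ, (univ.filter fun c => Inc c ℓ).card = r + 1) ∧
      ∀ c, (univ.filter fun ℓ => Inc c ℓ).card = r + 1 := by
  obtain ⟨q, hq, hprime⟩ := Nat.exists_infinite_primes r₀
  have := Fact.mk hprime
  let P := ℙ (ZMod q) (Fin 3 → ZMod q)
  let : Fintype P := Fintype.ofFinite P
  have hcard : Fintype.card P = 1 + q + q ^ 2 := by
    have h := Projectivization.card_of_finrank (ZMod q) (Fin 3 → ZMod q) (n := 3) (by simp)
    rw [← Nat.card_eq_fintype_card, h]
    simp [Finset.sum_range_succ]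
  have hP := ProjectivePlane.card_points P P
  refine ⟨ProjectivePlane.order P P, P, P, inferInstance, inferInstance, fun c ℓ => c ∈ ℓ, ?_,
    hP, hP, ?_, ?_, ?_, ?_⟩
  · rw [hcard] at hP
    refine hq.trans ?_
    by_contra h
    push Not at h
    nlinarith
  · intro ℓ ℓ'
    by_cases h : ℓ = ℓ'
    · subst h
      have h1 := ProjectivePlane.pointCount_eq P ℓ
      have : 0 < Nat.card {p : P // p ∈ ℓ} := by
        rw [show Nat.card {p : P // p ∈ ℓ} = pointCount P ℓ from rfl, h1]; omega
      obtain ⟨⟨c, hc⟩⟩ := (Nat.card_pos_iff.1 this).1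
      exact ⟨c, hc, hc⟩
    · exact ⟨HasPoints.mkPoint h, HasPoints.mkPoint_ax h⟩
  · intro c c' ℓ ℓ' hne h1 h2 h3 h4
    exact (Nondegenerate.eq_or_eq h1 h2 h3 h4).resolve_left hne
  · intro ℓ
    have h1 := ProjectivePlane.pointCount_eq P ℓ
    rw [pointCount, Nat.card_eq_fintype_card, Fintype.card_subtype] at h1
    convert h1
  · intro c
    have h1 := ProjectivePlane.lineCount_eq P c
    rw [lineCount, Nat.card_eq_fintype_card, Fintype.card_subtype] at h1
    convert h1

end Plane

/-! ### Approximate decompositions on arbitrary vertex types -/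

section Transport

theorem degIn_comap_equiv {V W : Type*} [Fintype V] [Fintype W] (e : W ≃ V) (G : SimpleGraph V)
    (x : W) : degIn (G.comap e) x univ = degIn G (e x) univ := by
  unfold degIn
  exact Finset.card_equiv e (by simp)

/-- The approximate decomposition property for graphs on arbitrary finite vertex types. -/
theorem ApproxDecompositionProperty.exists_threshold {δ : ℝ} (h : ApproxDecompositionProperty δ)
    {γ : ℝ} (hγ : 0 < γ) : ∃ n₀ : ℕ, ∀ (V : Type*) [Fintype V] (G : SimpleGraph V),
      n₀ ≤ Fintype.card V → (∀ x, δ * Fintype.card V ≤ degIn G x univ) →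
      ∃ H ≤ G, HasTriangleDecomposition H ∧
        ∀ x, (degIn (G \ H) x univ : ℝ) ≤ γ * Fintype.card V := by
  obtain ⟨n₀, hn₀⟩ := h γ hγ
  refine ⟨n₀ + 1, fun V _ G hn hdeg => ?_⟩
  set n := Fintype.card V with hnV
  let e : Fin n ≃ V := (Fintype.equivFin V).symm
  have : Nonempty (Fin n) := ⟨⟨0, by omega⟩⟩
  obtain ⟨F, hF⟩ : ∃ F, F = G.comap e := ⟨_, rfl⟩
  obtain ⟨H, hH, hdec, hmax⟩ := hn₀ n (by omega) F (by
    obtain ⟨x, hx⟩ := F.exists_minimal_degree_vertex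
    rw [hx, degree_eq_degIn, hF, degIn_comap_equiv]
    exact hdeg _)
  have hmap : (H.map e).comap e = H :=
    SimpleGraph.comap_map_eq e.toEmbedding H
  refine ⟨H.map e, ?_, hdec.map e.toEmbedding, fun x => ?_⟩
  · exact (SimpleGraph.map_le_iff_le_comap e.toEmbedding _ _).2 (hF ▸ hH)
  · refine le_trans ?_ hmax
    have h1 := (F \ H).degree_le_maxDegree (e.symm x)
    rw [degree_eq_degIn] at h1
    have h2 := degIn_comap_equiv e (G \ H.map e) (e.symm x)
    rw [Equiv.apply_symm_apply] at h2
    have h3 : (G \ H.map e).comap e = F \ H := by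
      conv_rhs => rw [← hmap, hF]
      rfl
    rw [← h2, h3]
    exact_mod_cast h1

end Transport

end

section

open Classical Finset

/-! ### Choice of parameters for the covering step -/

section CoverParameters

theorem exists_log_le_mul {p c : ℝ} (hp : 1 ≤ p) (hc : 0 < c) :
    ∃ n₀ : ℕ, ∀ x : ℝ, n₀ ≤ x → Real.log (2 * (x ^ 2 + 1) * p) ≤ c * x := by
  refine ⟨⌈24 * p / c ^ 3⌉₊ + 1, fun x hx => ?_⟩
  push_cast at hx
  have h0 : (0 : ℝ) ≤ (⌈24 * p / c ^ 3⌉₊ : ℝ) := by positivity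
  have h1 : 24 * p / c ^ 3 ≤ x := (Nat.le_ceil _).trans (by linarith)
  have h2 : 1 ≤ x := by linarith
  rw [Real.log_le_iff_le_exp (by positivity)]
  have h3 := Real.pow_div_factorial_le_exp (c * x) (by positivity) 3
  refine le_trans ?_ h3
  rw [div_le_iff₀ (by positivity)] at h1
  have h4 : ((3 : ℕ).factorial : ℝ) = 6 := by norm_num [Nat.factorial]
  rw [h4, le_div_iff₀ (by norm_num)]
  have h5 : 0 ≤ x ^ 2 := by positivity
  have h6 : 24 * p * x ^ 2 ≤ x * c ^ 3 * x ^ 2 := mul_le_mul_of_nonneg_right h1 h5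
  have h7 : 0 ≤ p * (x ^ 2 - 1) := mul_nonneg (by linarith) (by nlinarith)
  linarith

set_option maxHeartbeats 1000000 in
/-- If `G` has minimum degree somewhat above the approximate decomposition threshold, and each
vertex is adjacent to at least three quarters of `U`, then all edges not inside `U` can be covered
by edge-disjoint triangles of `G` using few edges at each vertex inside `U`. -/
theorem exists_cover {δ ε κ μ : ℝ} (h : ApproxDecompositionProperty δ) (hε : 0 < ε) (hκ : 0 < κ)
    (hμ : 0 < μ) : ∃ n₀ : ℕ, ∀ (V : Type*) [Fintype V] (G : SimpleGraph V) (U : Finset V),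
      n₀ ≤ Fintype.card V → κ * Fintype.card V ≤ U.card → U.card ≤ ε * Fintype.card V →
      (∀ x, (δ + 2 * ε) * Fintype.card V ≤ degIn G x univ) →
      (∀ x, 3 / 4 * (U.card : ℝ) ≤ degIn G x U) →
      (∀ x, x ∉ U → Even (degIn G x univ)) →
      ∃ H ≤ G, HasTriangleDecomposition H ∧
        (∀ x y, G.Adj x y → ¬(x ∈ U ∧ y ∈ U) → H.Adj x y) ∧
        ∀ x, x ∈ U → (degIn H x U : ℝ) ≤ μ * Fintype.card V := by
  obtain ⟨r, P, Λ, _, _, Inc, hr, hP, hΛ, hmeet, huniq, hline, hpoint⟩ :=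
    exists_projectivePlane (⌈4 / μ⌉₊ + ⌈2 / ε⌉₊ + ⌈40 / κ⌉₊ + 1)
  have hr' : (⌈4 / μ⌉₊ : ℝ) + ⌈2 / ε⌉₊ + ⌈40 / κ⌉₊ + 1 ≤ r := by exact_mod_cast hr
  have hr1 : (1 : ℝ) ≤ r := by
    have : (0 : ℝ) ≤ (⌈4 / μ⌉₊ : ℝ) + ⌈2 / ε⌉₊ + ⌈40 / κ⌉₊ := by positivity
    linarith
  have hr0 : (0 : ℝ) < r := by linarith
  have hn1 : (0 : ℝ) ≤ (⌈4 / μ⌉₊ : ℝ) := by positivity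
  have hn2 : (0 : ℝ) ≤ (⌈2 / ε⌉₊ : ℝ) := by positivity
  have hn3 : (0 : ℝ) ≤ (⌈40 / κ⌉₊ : ℝ) := by positivity
  have hrμ : 4 ≤ r * μ := by
    rw [← div_le_iff₀ hμ]; linarith [Nat.le_ceil (4 / μ)]
  have hrε : 2 ≤ r * ε := by
    rw [← div_le_iff₀ hε]; linarith [Nat.le_ceil (2 / ε)]
  have hrκ : 40 ≤ r * κ := by
    rw [← div_le_iff₀ hκ]; linarith [Nat.le_ceil (40 / κ)]
  obtain ⟨p, hpdef⟩ : ∃ p : ℝ, p = (r : ℝ) ^ 2 + r + 1 := ⟨_, rfl⟩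
  have hp1 : 1 ≤ p := by nlinarith
  have hp0 : 0 < p := by linarith
  have hPp : (Fintype.card P : ℝ) = p := by rw [hP, hpdef]; push_cast; ring
  have hΛp : (Fintype.card Λ : ℝ) = p := by rw [hΛ, hpdef]; push_cast; ring
  have : Nonempty P := Fintype.card_pos_iff.1 (by omega)
  have : Nonempty Λ := Fintype.card_pos_iff.1 (by omega)
  -- `η` bounds the relative error of the colourings by points and lines
  obtain ⟨η, hη⟩ : ∃ η, η = min (κ / (8 * p)) (1 / (3 * (r + 1) * p)) := ⟨_, rfl⟩
  have hη0 : 0 < η := by rw [hη]; positivity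
  have hη1 : 8 * (η * p) ≤ κ := by
    have := hη.le.trans (min_le_left _ _)
    rw [le_div_iff₀ (by positivity)] at this
    linarith
  have hη2 : 3 * ((r + 1) * η * p) ≤ 1 := by
    have := hη.le.trans (min_le_right _ _)
    rw [le_div_iff₀ (by positivity)] at this
    linarith
  -- the approximate decomposition leaves degrees at most `β ^ 2 * n`, so that the greedy cover of
  -- the leftover gets by with degrees `3 * β * n`
  obtain ⟨β, hβ⟩ : ∃ β, β = min (κ / (64 * p)) (min (1 / (12 * p)) (μ / 6)) := ⟨_, rfl⟩
  have hβ0 : 0 < β := by rw [hβ]; positivity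
  have hβ1 : 64 * (β * p) ≤ κ := by
    have := hβ.le.trans (min_le_left _ _)
    rw [le_div_iff₀ (by positivity)] at this
    linarith
  have hβ2 : 12 * (β * p) ≤ 1 := by
    have := hβ.le.trans ((min_le_right _ _).trans (min_le_left _ _))
    rw [le_div_iff₀ (by positivity)] at this
    linarith
  have hβ3 : 6 * β ≤ μ := by
    have := hβ.le.trans ((min_le_right _ _).trans (min_le_right _ _))
    linarith
  have hβle : β ≤ 1 := by nlinarith only [hβ2, hp1, hβ0]
  have hηle : η ≤ 1 := by nlinarith only [hη2, hp1, hη0, mul_pos (mul_pos hr0 hη0) hp0]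
  obtain ⟨n₁, hn₁⟩ := exists_log_le_mul (p := p) (c := η ^ 2 / 4) hp1 (by positivity)
  obtain ⟨n₂, hn₂⟩ := h.exists_threshold (γ := β ^ 2) (by positivity)
  refine ⟨n₁ + n₂ + ⌈2 / β⌉₊ + 1, fun V _ G U hn hU hU' hdeg hdegU heven => ?_⟩
  obtain ⟨n, hndef⟩ : ∃ n, n = Fintype.card V := ⟨_, rfl⟩
  have hβn : 2 ≤ β * n := by
    rw [mul_comm, ← div_le_iff₀ hβ0]
    exact (Nat.le_ceil _).trans (by exact_mod_cast (by omega : ⌈2 / β⌉₊ ≤ n))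
  have hn0 : (0 : ℝ) < n := by
    exact_mod_cast (by omega : 0 < n)
  have hlog := hn₁ n (by exact_mod_cast (by omega : n₁ ≤ n))
  have hη22 : η / 2 * (η / 2 * n) = η ^ 2 / 4 * n := by ring
  -- colour the vertices by points of the plane
  obtain ⟨χ, hχ⟩ := exists_balanced_colouring (C := P)
    (fun j : Option (V × V) => j.elim U fun q => U.filter fun v => G.Adj q.1 v ∧ G.Adj q.2 v)
    (l := η / 2) (by positivity) (by linarith)
  have hbound : (Fintype.card V : ℝ) * (η / 2) +
      Real.log (2 * (Fintype.card (Option (V × V)) : ℕ) * Fintype.card P) / (η / 2) ≤ η * n := by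
    have h1 : Real.log (2 * (Fintype.card (Option (V × V)) : ℕ) * Fintype.card P) / (η / 2) ≤
        η / 2 * n := by
      rw [div_le_iff₀ (by positivity), mul_comm (η / 2 * (n : ℝ)), hη22]
      refine le_trans (le_of_eq ?_) hlog
      rw [Fintype.card_option, Fintype.card_prod, ← hndef, hPp]
      push_cast
      ring_nf
    rw [← hndef]
    linarith
  -- colour the vertices by lines of the plane
  obtain ⟨lam, hlam⟩ := exists_balanced_colouring (C := Λ)
    (fun _ : Unit => (univ : Finset V)) (l := η / 2) (by positivity) (by linarith)
  have hbound' : (Fintype.card V : ℝ) * (η / 2) +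
      Real.log (2 * (Fintype.card Unit : ℕ) * Fintype.card Λ) / (η / 2) ≤ η * n := by
    have h1 : Real.log (2 * (Fintype.card Unit : ℕ) * Fintype.card Λ) / (η / 2) ≤
        η / 2 * n := by
      rw [div_le_iff₀ (by positivity), mul_comm (η / 2 * (n : ℝ)), hη22]
      refine le_trans ?_ hlog
      rw [Fintype.card_unit, hΛp]
      apply Real.log_le_log (by positivity)
      push_cast
      have := mul_nonneg (sq_nonneg (n : ℝ)) hp0.le
      linarith
    rw [← hndef]
    linarith
  have hs : (⌊κ * n / (4 * p)⌋₊ : ℝ) ≤ κ * n / (4 * p) := Nat.floor_le (by positivity)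
  have hs' := Nat.lt_floor_add_one (κ * n / (4 * p))
  have hb : (⌊β * n⌋₊ : ℝ) ≤ β * n := Nat.floor_le (by positivity)
  have hb' := Nat.lt_floor_add_one (β * n)
  have hd : (⌊β ^ 2 * n⌋₊ : ℝ) ≤ β ^ 2 * n := Nat.floor_le (by positivity)
  have hd' := Nat.lt_floor_add_one (β ^ 2 * n)
  have hββ : β ^ 2 * n ≤ β * n := by
    have := mul_le_mul_of_nonneg_right hβle (mul_pos hβ0 hn0).le
    linarith
  have hUn : (U.card : ℝ) ≤ n := by
    rw [hndef]; exact_mod_cast Finset.card_le_univ U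
  refine exists_cover_of_plane G U Inc χ lam r ⌊β * n⌋₊ ⌊β ^ 2 * n⌋₊ ⌊κ * n / (4 * p)⌋₊
    (δ := δ) (ε := ε) (κ := κ) (γ := β ^ 2) (η := η) (p := p) (θ := 3 * β) (τ := 2 / r) (μ := μ)
    hη0.le hp0 hmeet huniq hline hpoint ?_ ?_ ?_ hU hU' hdeg hdegU heven
    (fun G' hG' => hn₂ V G' (by omega) hG') ?_ ?_ ?_ ?_ ?_ ?_ ?_ ?_
  · intro x y c
    have := (hχ (some (x, y)) c).trans hbound
    rw [hPp] at this
    rw [← hndef]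
    exact this
  · intro c
    have := (abs_le.1 ((hχ none c).trans hbound)).2
    rw [hPp] at this
    rw [← hndef]
    simp only [Option.elim_none] at this
    linarith
  · intro ℓ
    have := (abs_le.1 ((hlam () ℓ).trans hbound')).2
    rw [hΛp, Finset.card_univ] at this
    rw [← hndef] at this ⊢
    linarith
  · rw [le_div_iff₀ hr0, ← mul_le_mul_iff_of_pos_left hp0]
    have e : p * ((r + 1) * (1 / p + η) * r) = (r + 1) * r + (r + 1) * η * p * r := by
      field_simp
    rw [e]
    have : (r + 1) * η * p * r ≤ 1 * r := mul_le_mul_of_nonneg_right (by linarith) hr0.le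
    nlinarith only [this, hpdef]
  · rw [div_le_iff₀ hr0]
    linarith
  · have : 2 / (r : ℝ) ≤ μ / 2 := by
      rw [div_le_iff₀ hr0]
      linarith
    linarith
  · rw [← hndef]
    exact hd'
  · rw [← hndef]
    refine hs.trans ?_
    rw [div_le_iff₀ (by positivity)]
    have e : (κ / (2 * p) * n - η * n) * (4 * p) = (2 * κ - 4 * (η * p)) * n := by
      field_simp
      ring
    rw [e]
    exact mul_le_mul_of_nonneg_right (by linarith) hn0.le
  · rw [← hndef]
    linarith
  · rw [← hndef]
    have hκp : 16 * (β * n) ≤ κ * n / (4 * p) := by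
      rw [le_div_iff₀ (by positivity)]
      have := mul_le_mul_of_nonneg_right hβ1 hn0.le
      linarith
    have key : (2 * ((⌊β * n⌋₊ : ℝ) + 2 + ⌊β ^ 2 * n⌋₊) * (⌊β * n⌋₊ + 1) + 2 * (n * ⌊β ^ 2 * n⌋₊)) <
        ⌊κ * n / (4 * p)⌋₊ * (⌊β * n⌋₊ + 1) := by
      set b := (⌊β * n⌋₊ : ℝ)
      set d := (⌊β ^ 2 * n⌋₊ : ℝ)
      set s := (⌊κ * n / (4 * p)⌋₊ : ℝ)
      have hb1 : 0 < b + 1 := by linarith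
      have h1 : (n : ℝ) * d ≤ β * n * (b + 1) := by
        calc (n : ℝ) * d ≤ n * (β ^ 2 * n) := mul_le_mul_of_nonneg_left hd hn0.le
          _ = β * n * (β * n) := by ring
          _ ≤ _ := mul_le_mul_of_nonneg_left hb'.le (by positivity)
      have h2 : 2 * (b + 2 + d) + 2 * (β * n) < s := by linarith
      have := mul_lt_mul_of_pos_right h2 hb1
      linarith
    exact_mod_cast key
  · intro D D' hD hD'
    rw [← hndef]
    rw [← hndef] at hU
    have e1 : (r + 1) * (D / p + η * n) + 2 * (n / p + η * n) =
        ((r + 1) * D + (r + 1) * η * p * n + 2 * n + 2 * (η * p) * n) / p := by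
      field_simp
      ring
    have e2 : 2 * ((r + 1) * (D' / p - η * n) - 2 * (3 * β * n) - (U.card / p + η * n)) =
        (2 * (r + 1) * D' - 2 * ((r + 1) * η * p) * n - 12 * (β * p) * n - 2 * U.card -
          2 * (η * p) * n) / p := by
      field_simp
      ring
    rw [e1, e2, div_le_div_iff_of_pos_right hp0]
    have h1 : (r + 1) * (κ * n / 4) ≤ (r + 1) * (2 * D' - D) :=
      mul_le_mul_of_nonneg_left (by linarith) (by linarith)
    have h2 : 40 * (n : ℝ) ≤ r * κ * n := mul_le_mul_of_nonneg_right hrκ hn0.le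
    have h3 := mul_le_mul_of_nonneg_right hη2 hn0.le
    have h4 := mul_le_mul_of_nonneg_right hβ2 hn0.le
    have h5 : 2 * (η * p) ≤ (r + 1) * η * p := by
      nlinarith only [mul_pos hη0 hp0, mul_nonneg (sub_nonneg.2 hr1) (mul_pos hη0 hp0).le]
    have h6 := mul_le_mul_of_nonneg_right h5 hn0.le
    have h7 : 0 ≤ κ * n := by positivity
    linarith

end CoverParameters

end

section

open Classical Finset

/-! ### Covering within a vertex set -/

section Restriction

variable {V W : Type*}

theorem degIn_le_card {G : SimpleGraph V} {x : V} {S T : Finset V}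
    (h : ∀ y ∈ S, G.Adj x y → y ∈ T) : degIn G x S ≤ T.card := by
  refine Finset.card_le_card fun y hy => ?_
  rw [Finset.mem_filter] at hy
  exact h y hy.1 hy.2

theorem degIn_le_degIn {G H : SimpleGraph V} {x : V} {S : Finset V}
    (h : ∀ y ∈ S, G.Adj x y → H.Adj x y) : degIn G x S ≤ degIn H x S := by
  refine Finset.card_le_card fun y hy => ?_
  rw [Finset.mem_filter] at hy ⊢
  exact ⟨hy.1, h y hy.1 hy.2⟩

theorem degIn_comap_embedding (f : W ↪ V) (G : SimpleGraph V) (x : W) (T : Finset W) :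
    degIn (G.comap f) x T = degIn G (f x) (T.map f) := by
  unfold degIn
  rw [Finset.filter_map, Finset.card_map]
  rfl

theorem degIn_map_embedding (f : W ↪ V) (H : SimpleGraph W) (x : W) (T : Finset W) :
    degIn (H.map f) (f x) (T.map f) = degIn H x T := by
  rw [← degIn_comap_embedding, SimpleGraph.comap_map_eq]

theorem degIn_eq_univ [Fintype V] {G : SimpleGraph V} {U : Finset V} (hGU : ∀ x y, G.Adj x y → y ∈ U)
    (x : V) : degIn G x U = degIn G x univ := by
  unfold degIn
  congr 1
  ext y
  simp only [Finset.mem_filter, Finset.mem_univ, true_and, and_iff_right_iff_imp]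
  exact hGU x y

theorem degIn_sdiff_add {G H : SimpleGraph V} (h : H ≤ G) (x : V) (S : Finset V) :
    degIn (G \ H) x S + degIn H x S = degIn G x S := by
  rw [← SimpleGraph.degIn_sup_of_disjoint, sdiff_sup_cancel h]
  exact fun a b hab => hab.2

/-- The version of `exists_cover` for a graph all of whose edges lie in a vertex set `U`. -/
theorem exists_cover_within {δ ε κ μ : ℝ} (h : ApproxDecompositionProperty δ) (hε : 0 < ε)
    (hκ : 0 < κ) (hμ : 0 < μ) : ∃ n₀ : ℕ, ∀ (V : Type*) [Fintype V] (G : SimpleGraph V)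
      (U W : Finset V), W ⊆ U → (∀ x y, G.Adj x y → x ∈ U ∧ y ∈ U) →
      n₀ ≤ U.card → κ * U.card ≤ W.card → W.card ≤ ε * U.card →
      (∀ x ∈ U, (δ + 2 * ε) * U.card ≤ degIn G x U) →
      (∀ x ∈ U, 3 / 4 * (W.card : ℝ) ≤ degIn G x W) →
      (∀ x ∈ U, x ∉ W → Even (degIn G x univ)) →
      ∃ H ≤ G, HasTriangleDecomposition H ∧
        (∀ x y, G.Adj x y → ¬(x ∈ W ∧ y ∈ W) → H.Adj x y) ∧
        ∀ x, x ∈ W → (degIn H x W : ℝ) ≤ μ * U.card := by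
  obtain ⟨n₀, hn₀⟩ := exists_cover h hε hκ hμ
  refine ⟨n₀, fun V _ G U W hWU hGU hn hW hW' hdeg hdegW heven => ?_⟩
  let f : U ↪ V := Function.Embedding.subtype fun x => x ∈ U
  have hf : ∀ x : U, f x = x := fun _ => rfl
  have hU : (univ : Finset U).map f = U := by
    ext x; simp [f]
  have hWm : (W.subtype fun x => x ∈ U).map f = W := by
    ext x
    simp only [f, Finset.subtype_map, Finset.mem_filter, and_iff_left_iff_imp]
    exact fun hx => hWU hx
  have hWc : (W.subtype fun x => x ∈ U).card = W.card := by
    rw [← Finset.card_map f, hWm]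
  have hUc : Fintype.card U = U.card := Fintype.card_coe U
  obtain ⟨H, hH, hdec, hcov, hmax⟩ := hn₀ U (G.comap f) (W.subtype fun x => x ∈ U)
    (by rw [hUc]; exact hn) (by rw [hUc, hWc]; exact hW) (by rw [hUc, hWc]; exact hW')
    (fun x => by
      rw [degIn_comap_embedding, hU, hUc]
      exact hdeg x x.2)
    (fun x => by
      rw [degIn_comap_embedding, hWm, hWc]
      exact hdegW x x.2)
    (fun x hx => by
      rw [degIn_comap_embedding, hU, degIn_eq_univ (fun a b hab => (hGU a b hab).2)]
      exact heven x x.2 fun hxW => hx (Finset.mem_subtype.2 hxW))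
  refine ⟨H.map f, (SimpleGraph.map_le_iff_le_comap f _ _).2 hH, hdec.map f, ?_, ?_⟩
  · intro x y hxy hW
    obtain ⟨hx, hy⟩ := hGU x y hxy
    have := hcov ⟨x, hx⟩ ⟨y, hy⟩ hxy (by simpa using hW)
    exact (SimpleGraph.map_adj f H x y).2 ⟨_, _, this, rfl, rfl⟩
  · intro x hx
    have h1 := hmax ⟨x, hWU hx⟩ (Finset.mem_subtype.2 hx)
    rw [← degIn_map_embedding f, hWm, hUc] at h1
    exact h1

end Restriction

/-! ### Covering along a vortex -/

section Vortex

variable {V : Type*}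

/-- The requirement on two successive sets `U ⊇ U'` of a vortex: `U` has at least `m` vertices, the
size of `U'` is between `κ` and `ε` times that of `U`, and every vertex of `U` is adjacent to a
proportion at least `α` of `U'`. -/
structure VortexStep (G : SimpleGraph V) (m : ℕ) (α ε κ : ℝ) (U U' : Finset V) : Prop where
  subset : U' ⊆ U
  le_card : m ≤ U.card
  card_lower : κ * U.card ≤ U'.card
  card_upper : U'.card ≤ ε * U.card
  le_degIn : ∀ x ∈ U, α * U'.card ≤ degIn G x U'

/-- `IsVortex G m α ε κ U U' W` says that there is a descending sequence of vertex sets with first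
set `U`, second set `U'` and last set `W` in which any two successive sets satisfy `VortexStep`. The
second set is recorded because the edges inside it have to be preserved while those outside `U` are
being covered. -/
inductive IsVortex (G : SimpleGraph V) (m : ℕ) (α ε κ : ℝ) :
    Finset V → Finset V → Finset V → Prop
  | single {U W : Finset V} : VortexStep G m α ε κ U W → IsVortex G m α ε κ U W W
  | cons {U U' U'' W : Finset V} : VortexStep G m α ε κ U U' → IsVortex G m α ε κ U' U'' W →
      IsVortex G m α ε κ U U' W

theorem IsVortex.step {G : SimpleGraph V} {m : ℕ} {α ε κ : ℝ} {U U' W : Finset V}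
    (h : IsVortex G m α ε κ U U' W) : VortexStep G m α ε κ U U' := by
  cases h <;> assumption

theorem IsVortex.subset {G : SimpleGraph V} {m : ℕ} {α ε κ : ℝ} {U U' W : Finset V}
    (h : IsVortex G m α ε κ U U' W) : W ⊆ U' := by
  induction h with
  | single h => exact subset_rfl
  | cons h h' ih => exact ih.trans h'.step.subset

/-- Along a vortex, all edges outside its last set `W` can be covered by edge-disjoint triangles.
The graph `F` is what remains of `G` inside the first set `U` once the edges outside `U` have been
covered; it has all edges of `G` inside the second set `U'`, and it misses few edges of `G` at each
vertex. -/
theorem exists_cover_of_isVortex {δ ε κ : ℝ} (h : ApproxDecompositionProperty δ)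
    (hδ : 3 / 4 ≤ δ) (hε : 0 < ε) (hκ : 0 < κ) (hκ1 : κ ≤ 1) :
    ∃ m : ℕ, ∀ (V : Type*) [Fintype V] (G : SimpleGraph V) (U U' W : Finset V),
      IsVortex G m (δ + 4 * ε) ε κ U U' W → ∀ F ≤ G,
      (∀ x y, F.Adj x y → x ∈ U ∧ y ∈ U) →
      (∀ x y, x ∈ U' → y ∈ U' → G.Adj x y → F.Adj x y) →
      (∀ x ∈ U, (δ + 4 * ε) * U.card ≤ degIn G x U) →
      (∀ x ∈ U, (degIn (G \ F) x U : ℝ) ≤ ε * κ * U.card) →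
      (∀ x ∈ U, x ∉ W → Even (degIn F x univ)) →
      ∃ H ≤ F, HasTriangleDecomposition H ∧
        ∀ x y, F.Adj x y → ¬(x ∈ W ∧ y ∈ W) → H.Adj x y := by
  obtain ⟨m, hm⟩ := exists_cover_within (δ := δ) (ε := ε) (κ := κ) (μ := ε * κ * κ) h hε hκ
    (by positivity)
  refine ⟨m, fun V _ G U U' W hvortex => ?_⟩
  -- the degrees of `F` into `U` and `U'`
  have hdegF : ∀ {F : SimpleGraph V} {U U' : Finset V}, F ≤ G →
      VortexStep G m (δ + 4 * ε) ε κ U U' →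
      (∀ x ∈ U, (δ + 4 * ε) * U.card ≤ degIn G x U) →
      (∀ x ∈ U, (degIn (G \ F) x U : ℝ) ≤ ε * κ * U.card) →
      (∀ x ∈ U, (δ + 3 * ε) * U.card ≤ degIn F x U) ∧
        ∀ x ∈ U, (δ + 3 * ε) * U'.card ≤ degIn F x U' := by
    intro F U U' hFG hstep hdeg hloss
    refine ⟨fun x hx => ?_, fun x hx => ?_⟩
    · have h1 : (degIn (G \ F) x U : ℝ) + degIn F x U = degIn G x U := by
        exact_mod_cast degIn_sdiff_add hFG x U
      have h2 := hdeg x hx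
      have h3 := hloss x hx
      have h4 : ε * κ * U.card ≤ ε * U.card :=
        mul_le_mul_of_nonneg_right (by nlinarith) (by positivity)
      linarith
    · have h1 : (degIn (G \ F) x U' : ℝ) + degIn F x U' = degIn G x U' := by
        exact_mod_cast degIn_sdiff_add hFG x U'
      have h2 := hstep.le_degIn x hx
      have h3 := hloss x hx
      have h4 : (degIn (G \ F) x U' : ℝ) ≤ degIn (G \ F) x U := by
        exact_mod_cast degIn_mono le_rfl x hstep.subset
      have h5 := mul_le_mul_of_nonneg_left hstep.card_lower hε.le
      linarith
  induction hvortex with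
  | single hstep =>
    intro F hFG hFU hFU' hdeg hloss heven
    obtain ⟨h1, h2⟩ := hdegF hFG hstep hdeg hloss
    obtain ⟨H, hH, hdec, hcov, -⟩ := hm V F _ _ hstep.subset hFU hstep.le_card hstep.card_lower
      hstep.card_upper
      (fun x hx => le_trans (mul_le_mul_of_nonneg_right (by linarith) (by positivity)) (h1 x hx))
      (fun x hx => le_trans (mul_le_mul_of_nonneg_right (by linarith) (by positivity)) (h2 x hx))
      heven
    exact ⟨H, hH, hdec, hcov⟩
  | @cons U U' U'' W hstep hvortex ih =>
    intro F hFG hFU hFU' hdeg hloss heven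
    obtain ⟨h1, h2⟩ := hdegF hFG hstep hdeg hloss
    have hstep' := hvortex.step
    -- the edges inside `U''` are kept for the later steps
    let K : SimpleGraph V :=
      { Adj := fun x y => F.Adj x y ∧ x ∈ U'' ∧ y ∈ U''
        symm := ⟨fun x y hxy => ⟨hxy.1.symm, hxy.2.2, hxy.2.1⟩⟩
        loopless := ⟨fun x hx => F.loopless.irrefl x hx.1⟩ }
    have hKF : K ≤ F := fun x y hxy => hxy.1
    have hKdeg : ∀ x S, degIn K x S ≤ U''.card := fun x S =>
      degIn_le_card fun y _ hxy => hxy.2.2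
    have hU''U : (U''.card : ℝ) ≤ ε * U'.card := hstep'.card_upper
    have hU'U : (U'.card : ℝ) ≤ U.card := by exact_mod_cast Finset.card_le_card hstep.subset
    obtain ⟨H, hH, hdec, hcov, hmax⟩ := hm V (F \ K) U U' hstep.subset
      (fun x y hxy => hFU x y hxy.1) hstep.le_card hstep.card_lower hstep.card_upper
      (fun x hx => by
        have e1 : (degIn (F \ K) x U : ℝ) + degIn K x U = degIn F x U := by
          exact_mod_cast degIn_sdiff_add hKF x U
        have e2 : (degIn K x U : ℝ) ≤ U''.card := by exact_mod_cast hKdeg x U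
        have e3 := mul_le_mul_of_nonneg_left hU'U hε.le
        linarith [h1 x hx])
      (fun x hx => by
        have e1 : (degIn (F \ K) x U' : ℝ) + degIn K x U' = degIn F x U' := by
          exact_mod_cast degIn_sdiff_add hKF x U'
        have e2 : (degIn K x U' : ℝ) ≤ U''.card := by exact_mod_cast hKdeg x U'
        have e3 : 3 / 4 * (U'.card : ℝ) ≤ δ * U'.card :=
          mul_le_mul_of_nonneg_right hδ (by positivity)
        have e4 : 0 ≤ ε * U'.card := by positivity
        linarith [h2 x hx])
      (fun x hx hxU' => by
        have e1 := degIn_sdiff_add hKF x univ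
        have e2 : degIn K x univ = 0 := by
          refine Nat.le_zero.1 (degIn_le_card (T := ∅) fun y _ hxy => ?_)
          exact absurd (hstep'.subset hxy.2.1) hxU'
        rw [e2, add_zero] at e1
        rw [e1]
        exact heven x hx fun hxW => hxU' (hstep'.subset (hvortex.subset hxW)))
    have hHF : H ≤ F := hH.trans sdiff_le
    -- all edges left over lie inside `U'`
    have hleft : ∀ x y, (F \ H).Adj x y → x ∈ U' ∧ y ∈ U' := by
      intro x y hxy
      by_contra hcon
      refine hxy.2 (hcov x y ⟨hxy.1, fun hK => hcon ?_⟩ hcon)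
      exact ⟨hstep'.subset hK.2.1, hstep'.subset hK.2.2⟩
    obtain ⟨H', hH', hdec', hcov'⟩ := ih (F \ H) (sdiff_le.trans hFG) hleft
      (fun x y hx hy hxy => by
        have hF := hFU' x y (hstep'.subset hx) (hstep'.subset hy) hxy
        exact ⟨hF, fun hHxy => (hH hHxy).2 ⟨hF, hx, hy⟩⟩)
      (fun x hx => hstep.le_degIn x (hstep.subset hx))
      (fun x hx => by
        have e1 : degIn (G \ (F \ H)) x U' ≤ degIn H x U' := by
          refine degIn_le_degIn fun y hy hxy => ?_
          by_contra hHxy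
          exact hxy.2 ⟨hFU' x y hx hy hxy.1, hHxy⟩
        have e2 : (degIn (G \ (F \ H)) x U' : ℝ) ≤ degIn H x U' := by exact_mod_cast e1
        have e3 := mul_le_mul_of_nonneg_left hstep.card_lower (mul_pos hε hκ).le
        linarith [hmax x hx])
      (fun x hx hxW => by
        have e1 := degIn_sdiff_add hHF x univ
        have e2 := heven x (hstep.subset hx) hxW
        rw [← e1, Nat.even_add] at e2
        exact e2.2 (hdec.divisible.1 x))
    refine ⟨H ⊔ H', sup_le hHF (hH'.trans sdiff_le), hdec.sup hdec' ?_, ?_⟩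
    · intro x y hxy hxy'
      exact (hH' hxy').2 hxy
    · intro x y hxy hW
      by_cases hHxy : H.Adj x y
      · exact Or.inl hHxy
      · exact Or.inr (hcov' x y ⟨hxy, hHxy⟩ hW)

end Vortex

end

section

open Classical Finset

/-! ### Existence of vortices -/

section VortexExistence

/-- The relative degree that may be lost on the way to a vortex set of size `n`. When the size
drops by a factor of at least `16`, this quantity at least doubles, so the losses along a vortex add
up to at most the last of them. -/
noncomputable def vortexSlack (n : ℝ) : ℝ := √(√(1 / n))

theorem vortexSlack_nonneg (n : ℝ) : 0 ≤ vortexSlack n := Real.sqrt_nonneg _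

theorem vortexSlack_sq_mul {n : ℝ} (hn : 0 < n) : vortexSlack n ^ 2 * n = √n := by
  rw [vortexSlack, Real.sq_sqrt (Real.sqrt_nonneg _), Real.sqrt_div zero_le_one, Real.sqrt_one]
  have h : 0 < √n := Real.sqrt_pos.2 hn
  field_simp
  rw [Real.sq_sqrt hn.le]

theorem vortexSlack_le {n d : ℝ} (hd : 0 ≤ d) (h : 1 / n ≤ d ^ 4) : vortexSlack n ≤ d := by
  refine Real.sqrt_le_iff.2 ⟨hd, Real.sqrt_le_iff.2 ⟨by positivity, h.trans (le_of_eq (by ring))⟩⟩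

theorem two_mul_vortexSlack_le {n k : ℝ} (hk : 0 < k) (h : 16 * k ≤ n) :
    2 * vortexSlack n ≤ vortexSlack k := by
  have h1 : 1 / n ≤ 1 / k / 16 := by
    rw [div_div, mul_comm]
    exact one_div_le_one_div_of_le (by positivity) h
  have h2 : √(1 / k / 16) = √(1 / k) / 4 := by
    rw [Real.sqrt_div' _ (by norm_num), show (16 : ℝ) = 4 ^ 2 by norm_num,
      Real.sqrt_sq (by norm_num)]
  have h3 : √(√(1 / k) / 4) = √(√(1 / k)) / 2 := by
    rw [Real.sqrt_div' _ (by norm_num), show (4 : ℝ) = 2 ^ 2 by norm_num,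
      Real.sqrt_sq (by norm_num)]
  have h4 : vortexSlack n ≤ √(√(1 / k)) / 2 := by
    rw [← h3, ← h2]
    exact Real.sqrt_le_sqrt (Real.sqrt_le_sqrt h1)
  rw [vortexSlack] at h4 ⊢
  rw [vortexSlack]
  linarith

/-- A random subset of density about `1 / K` roughly preserves relative degrees. -/
theorem exists_subset_degIn {K : ℕ} (hK : 32 ≤ K) : ∃ m : ℕ, ∀ (V : Type*) [Fintype V]
    (G : SimpleGraph V) (β : ℝ), m ≤ Fintype.card V → (∀ x, (β - vortexSlack (Fintype.card V)) *
      Fintype.card V ≤ degIn G x univ) → ∃ U : Finset V, (Fintype.card V : ℝ) / (2 * K) ≤ U.card ∧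
      U.card ≤ 2 * (Fintype.card V : ℝ) / K ∧
      ∀ x, (β - vortexSlack U.card) * U.card ≤ degIn G x U := by
  have hK' : (32 : ℝ) ≤ K := by exact_mod_cast hK
  have hK0 : (0 : ℝ) < K := by linarith
  obtain ⟨m, hm⟩ := exists_log_le_mul (p := K) (c := 1 / (128 * (K : ℝ) ^ 2)) (by linarith)
    (by positivity)
  refine ⟨m ^ 2 + 1, fun V _ G β hn hdeg => ?_⟩
  obtain ⟨n, hndef⟩ : ∃ n : ℝ, n = Fintype.card V := ⟨_, rfl⟩
  have hn1 : 1 ≤ n := by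
    rw [hndef]; exact_mod_cast (Nat.le_add_left 1 _).trans hn
  have hn0 : 0 < n := by linarith
  obtain ⟨x₀⟩ : Nonempty V := Fintype.card_pos_iff.1 (by omega)
  have hmn : (m : ℝ) ≤ √n := by
    refine Real.le_sqrt_of_sq_le ?_
    rw [hndef]; exact_mod_cast (Nat.le_succ _).trans hn
  have hlog := hm _ hmn
  rw [Real.sq_sqrt hn0.le] at hlog
  set y := vortexSlack n with hy
  have hy2 : y ^ 2 * n = √n := vortexSlack_sq_mul hn0
  have hy0 : 0 < y := by
    rw [hy, vortexSlack]
    positivity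
  have hy1 : y ≤ 1 := by
    refine vortexSlack_le zero_le_one ?_
    rw [one_pow, div_le_one hn0]
    exact hn1
  rw [← hndef] at hdeg
  -- colour randomly with `K` colours and take one colour class; `t` bounds the deviations
  obtain ⟨C, _, c₀, hC⟩ : ∃ (C : Type) (_ : Fintype C) (_ : C), Fintype.card C = K :=
    ⟨Fin K, inferInstance, ⟨0, by omega⟩, Fintype.card_fin K⟩
  have : Nonempty C := ⟨c₀⟩
  obtain ⟨χ, hχ⟩ := exists_balanced_colouring (C := C)
    (fun j : Option V => j.elim univ fun x => univ.filter fun v => G.Adj x v)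
    (l := y / (16 * K)) (by positivity) (by rw [div_le_one (by positivity)]; linarith)
  obtain ⟨t, ht⟩ : ∃ t, t = n * y / (4 * K) := ⟨_, rfl⟩
  have ht0 : 0 ≤ t := by rw [ht]; positivity
  have hbound : (Fintype.card V : ℝ) * (y / (16 * K)) +
      Real.log (2 * (Fintype.card (Option V) : ℕ) * Fintype.card C) / (y / (16 * K)) ≤
        t := by
    have h1 : Real.log (2 * (Fintype.card (Option V) : ℕ) * Fintype.card C) /
        (y / (16 * K)) ≤ n * y / (8 * K) := by
      rw [div_le_iff₀ (by positivity)]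
      have e : n * y / (8 * K) * (y / (16 * K)) = 1 / (128 * (K : ℝ) ^ 2) * √n := by
        rw [← hy2]
        field_simp
        norm_num
      rw [e, Fintype.card_option, hC, Nat.cast_succ, ← hndef]
      exact hlog
    rw [← hndef]
    have h2 : n * (y / (16 * K)) = n * y / (4 * K) * (1 / 4) := by field_simp; norm_num
    have h3 : n * y / (8 * K) = n * y / (4 * K) * (1 / 2) := by field_simp; norm_num
    rw [h2]
    rw [h3] at h1
    rw [ht] at ht0 ⊢
    linarith
  set U := univ.filter fun v => χ v = c₀ with hU
  have hUabs : |(U.card : ℝ) - n / K| ≤ t := by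
    have h := (hχ none c₀).trans hbound
    rw [hC] at h
    simp only [Option.elim_none, Finset.card_univ, ← hndef] at h
    exact h
  obtain ⟨hU1, hU2⟩ := abs_le.1 hUabs
  have htn : t ≤ n / K * (1 / 4) := by
    have e : n / K * (1 / 4) = n * 1 / (4 * K) := by field_simp
    rw [ht, e]
    gcongr
  have hlow : n / (2 * K) = n / K * (1 / 2) := by field_simp
  have hlow' : n / (2 * K) ≤ U.card := by
    rw [hlow]
    have : 0 < n / K := by positivity
    linarith
  have hup : (U.card : ℝ) ≤ 2 * n / K := by
    have : 0 < n / K := by positivity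
    have e : 2 * n / K = n / K * 2 := by ring
    rw [e]
    linarith
  have hUpos : (0 : ℝ) < U.card := lt_of_lt_of_le (by positivity) hlow'
  have hslack : 2 * y ≤ vortexSlack U.card := by
    refine two_mul_vortexSlack_le hUpos ?_
    rw [le_div_iff₀ hK0] at hup
    nlinarith
  refine ⟨U, by rw [← hndef]; exact hlow', by rw [← hndef]; exact hup, fun x => ?_⟩
  rcases le_or_gt (β - y) 0 with hneg | hpos
  · refine le_trans (mul_nonpos_of_nonpos_of_nonneg (by linarith) hUpos.le) (by positivity)
  · have hle1 : β - y ≤ 1 := by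
      have h1 := hdeg x₀
      have h2 : (degIn G x₀ univ : ℝ) ≤ n := by
        rw [hndef]; exact_mod_cast Finset.card_le_univ _
      by_contra hcon
      push Not at hcon
      have := mul_lt_mul_of_pos_right hcon hn0
      linarith
    have h1 := (abs_le.1 ((hχ (some x) c₀).trans hbound)).1
    rw [hC] at h1
    simp only [Option.elim_some] at h1
    have h2 : degIn G x U =
        ((univ.filter fun v => G.Adj x v).filter fun v => χ v = c₀).card := by
      rw [degIn, hU, Finset.filter_comm]
    have h3 : (β - y) * n / K ≤ ((univ.filter fun v => G.Adj x v).card : ℝ) / K := by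
      gcongr
      exact hdeg x
    rw [h2]
    have h4 : (β - y) * (U.card - n / K) ≤ 1 * t :=
      (mul_le_mul_of_nonneg_left hU2 hpos.le).trans (mul_le_mul_of_nonneg_right hle1 ht0)
    have h5 : y * (n / (2 * K)) ≤ y * U.card := mul_le_mul_of_nonneg_left hlow' hy0.le
    have h6 : y * (n / (2 * K)) = 2 * t := by rw [ht]; field_simp; norm_num
    have h7 : (β - vortexSlack U.card) * U.card ≤ (β - 2 * y) * U.card :=
      mul_le_mul_of_nonneg_right (by linarith) hUpos.le
    have h8 : (β - y) * (U.card - n / K) = (β - y) * U.card - (β - y) * n / K := by ring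
    rw [h8] at h4
    linarith

/-- Vortices exist in graphs of large minimum degree. -/
theorem exists_isVortex {ε : ℝ} (hε : 0 < ε) : ∃ κ : ℝ, 0 < κ ∧ κ ≤ 1 ∧
    ∀ (m : ℕ) (α β : ℝ), α < β → ∃ M : ℕ, ∀ (V : Type*) [Fintype V] (G : SimpleGraph V),
      M ≤ Fintype.card V → (∀ x, β * Fintype.card V ≤ degIn G x univ) →
      ∃ U W, IsVortex G m α ε κ univ U W ∧ W.card ≤ M := by
  obtain ⟨K, hK⟩ : ∃ K : ℕ, K = ⌈2 / ε⌉₊ + 32 := ⟨_, rfl⟩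
  have hK32 : 32 ≤ K := by omega
  have hK' : (32 : ℝ) ≤ K := by exact_mod_cast hK32
  have hK0 : (0 : ℝ) < K := by linarith
  have hKε : 2 ≤ ε * K := by
    rw [mul_comm, ← div_le_iff₀ hε]
    exact (Nat.le_ceil _).trans (by exact_mod_cast (by omega : ⌈2 / ε⌉₊ ≤ K))
  refine ⟨1 / (2 * K), by positivity, by rw [div_le_one (by positivity)]; linarith,
    fun m α β hαβ => ?_⟩
  obtain ⟨m', hm'⟩ := exists_subset_degIn hK32
  obtain ⟨M, hM⟩ : ∃ M : ℕ, M = m + m' + ⌈2 * K / (β - α) ^ 4⌉₊ + 1 := ⟨_, rfl⟩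
  refine ⟨M, fun V _ G hV hdeg => ?_⟩
  -- refine until the last set has fewer than `M` vertices
  have key : ∀ k : ℕ, ∀ U : Finset V, U.card = k → M ≤ k →
      (∀ x ∈ U, (β - vortexSlack U.card) * U.card ≤ degIn G x U) →
      ∃ U' W, IsVortex G m α ε (1 / (2 * K)) U U' W ∧ W.card ≤ M := by
    intro k
    induction k using Nat.strong_induction_on with
    | _ k ih =>
    intro U hUk hk hU
    let f : U ↪ V := Function.Embedding.subtype fun x => x ∈ U
    have hUf : (univ : Finset U).map f = U := by
      ext x; simp [f]
    have hUc : Fintype.card U = U.card := Fintype.card_coe U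
    obtain ⟨S, hS1, hS2, hS3⟩ := hm' U (G.comap f) β (by omega) (fun x => by
      rw [degIn_comap_embedding, hUf, hUc]
      exact hU x x.2)
    rw [hUc, ← Finset.card_map f] at hS1 hS2
    have hsub : S.map f ⊆ U := by
      intro x hx
      obtain ⟨y, -, rfl⟩ := Finset.mem_map.1 hx
      exact y.2
    have hS3' : ∀ x ∈ U, (β - vortexSlack (S.map f).card) * (S.map f).card ≤
        degIn G x (S.map f) := by
      intro x hx
      have := hS3 ⟨x, hx⟩
      rw [degIn_comap_embedding, ← Finset.card_map f] at this
      exact this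
    set U' := S.map f
    have hU0 : (0 : ℝ) < U.card := by exact_mod_cast (by omega : 0 < U.card)
    have hU'0 : (0 : ℝ) < U'.card := lt_of_lt_of_le (by positivity) hS1
    have hslack : vortexSlack U'.card ≤ β - α := by
      have hd : 0 < β - α := by linarith
      refine vortexSlack_le hd.le ?_
      have h1 : 2 * K / (β - α) ^ 4 ≤ U.card :=
        (Nat.le_ceil _).trans (by exact_mod_cast (by omega : ⌈2 * K / (β - α) ^ 4⌉₊ ≤ U.card))
      rw [div_le_iff₀ (by positivity)] at h1 ⊢
      rw [div_le_iff₀ (by positivity)] at hS1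
      have h2 := mul_le_mul_of_nonneg_right hS1 (pow_pos hd 4).le
      have h3 : 2 * (K : ℝ) * 1 ≤ 2 * K * ((β - α) ^ 4 * U'.card) := by linarith
      exact le_of_mul_le_mul_left h3 (by positivity)
    have hstep : VortexStep G m α ε (1 / (2 * K)) U U' :=
      { subset := hsub
        le_card := by omega
        card_lower := le_trans (le_of_eq (by ring)) hS1
        card_upper := by
          refine hS2.trans ?_
          rw [div_le_iff₀ hK0]
          have := mul_le_mul_of_nonneg_right hKε hU0.le
          linarith
        le_degIn := fun x hx => le_trans
          (mul_le_mul_of_nonneg_right (by linarith) hU'0.le) (hS3' x hx) }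
    have hlt : U'.card < U.card := by
      rw [le_div_iff₀ hK0] at hS2
      have : (U'.card : ℝ) < U.card := by nlinarith
      exact_mod_cast this
    by_cases hM' : M ≤ U'.card
    · obtain ⟨U'', W, hvortex, hW⟩ := ih U'.card (hUk ▸ hlt) U' rfl hM'
        fun x hx => hS3' x (hsub hx)
      exact ⟨U', W, .cons hstep hvortex, hW⟩
    · exact ⟨U', U', .single hstep, by omega⟩
  refine key _ univ rfl (by rw [Finset.card_univ]; exact hV) fun x _ => le_trans ?_ (hdeg x)
  rw [Finset.card_univ]
  exact mul_le_mul_of_nonneg_right (by linarith [vortexSlack_nonneg (Fintype.card V)])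
    (by positivity)

end VortexExistence

end

section

open Classical Finset

/-! ### Absorbers for all possible leftovers -/

section AbsorberFamily

/-- Absorbers for all graphs `L` of a family on the same vertex set, chosen one after the other
with disjoint sets of new vertices. Their union `A` absorbs each single member of the family: the
absorbers of the other members are decomposable by themselves. -/
theorem exists_absorber_family {V R : Type*} [Fintype V] [Fintype R] (ι : R ↪ V)
    (G : SimpleGraph V) (B : Finset V) (hB : ∀ r, ι r ∈ B) (𝓛 : Finset (SimpleGraph R))
    (h𝓛 : ∀ L ∈ 𝓛, (∀ r, Even (degIn L r univ)) ∧ 3 ∣ L.edgeSet.ncard)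
    (hG : ∀ Q : Finset V, Q.card ≤ 4 → B.card + 𝓛.card * Nat.card (AbsorberVertex R) <
      (univ.filter fun v => ∀ q ∈ Q, G.Adj v q).card) :
    ∃ (A : SimpleGraph V) (N : Finset V), A ≤ G ∧
      N.card ≤ 𝓛.card * Nat.card (AbsorberVertex R) ∧ (∀ x ∈ N, x ∉ B) ∧
      (∀ x y, A.Adj x y → (x ∈ N ∨ y ∈ N) ∧ (x ∈ N ∨ ∃ r, ι r = x)) ∧
      HasTriangleDecomposition A ∧ ∀ L ∈ 𝓛, HasTriangleDecomposition (A ⊔ L.map ι) := by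
  induction 𝓛 using Finset.induction_on with
  | empty =>
    exact ⟨⊥, ∅, bot_le, by simp, by simp, by simp, hasTriangleDecomposition_bot, by simp⟩
  | insert L 𝓛 hL ih =>
    rw [Finset.card_insert_of_notMem hL, add_mul, one_mul] at hG
    obtain ⟨A, N, hAG, hN, hNB, hA, hAdec, hAL⟩ := ih
      (fun L' hL' => h𝓛 L' (Finset.mem_insert_of_mem hL'))
      (fun Q hQ => lt_of_le_of_lt (by omega) (hG Q hQ))
    obtain ⟨h1, h2⟩ := h𝓛 L (Finset.mem_insert_self _ _)
    obtain ⟨A', N', hAG', hN', hNB', hA', hAdec', hAL'⟩ := exists_absorber ι G L h1 h2 (B ∪ N)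
      (fun Q hQ => lt_of_le_of_lt (by
        have := Finset.card_union_le B N
        omega) (hG Q hQ))
    have hold : ∀ x y, A.Adj x y → x ∉ N' := by
      intro x y hxy hx
      refine hNB' x hx (Finset.mem_union.2 ?_)
      rcases (hA x y hxy).2 with h | ⟨r, rfl⟩
      · exact Or.inr h
      · exact Or.inl (hB r)
    have hmap : ∀ (L' : SimpleGraph R) x y, (L'.map ι).Adj x y → x ∉ N' := by
      rintro L' _ _ ⟨-, u, v, -, rfl, rfl⟩ hx
      exact hNB' _ hx (Finset.mem_union_left _ (hB u))
    have hnew : ∀ x y, A'.Adj x y → x ∈ N' ∨ y ∈ N' := fun x y hxy => (hA' x y hxy).1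
    have hdisj : ∀ x y, A.Adj x y → ¬ A'.Adj x y := fun x y hxy hxy' =>
      (hnew x y hxy').elim (hold x y hxy) (hold y x hxy.symm)
    have hdisj' : ∀ (L' : SimpleGraph R) x y, (L'.map ι).Adj x y → ¬ A'.Adj x y :=
      fun L' x y hxy hxy' => (hnew x y hxy').elim (hmap L' x y hxy) (hmap L' y x hxy.symm)
    have hdisj'' : ∀ (L' : SimpleGraph R) x y, (L'.map ι).Adj x y → ¬ A.Adj x y := by
      rintro L' _ _ ⟨-, u, v, -, rfl, rfl⟩ hxy
      exact (hA _ _ hxy).1.elim (fun h => hNB _ h (hB u)) (fun h => hNB _ h (hB v))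
    refine ⟨A ⊔ A', N ∪ N', sup_le hAG hAG', ?_, ?_, ?_, hAdec.sup hAdec' hdisj, ?_⟩
    · rw [Finset.card_insert_of_notMem hL, add_mul, one_mul]
      exact (Finset.card_union_le N N').trans (add_le_add hN hN')
    · intro x hx
      rcases Finset.mem_union.1 hx with h | h
      · exact hNB x h
      · exact fun hxB => hNB' x h (Finset.mem_union_left _ hxB)
    · rintro x y (hxy | hxy)
      · have := hA x y hxy
        simp only [Finset.mem_union]
        tauto
      · have := hA' x y hxy
        simp only [Finset.mem_union]
        tauto
    · intro L' hL'
      rcases Finset.mem_insert.1 hL' with rfl | hL'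
      · rw [sup_assoc]
        exact hAdec.sup hAL' fun x y hxy hxy' =>
          hxy'.elim (hdisj x y hxy) fun h => hdisj'' _ x y h hxy
      · rw [sup_right_comm]
        exact (hAL L' hL').sup hAdec' fun x y hxy hxy' =>
          hxy.elim (fun h => hdisj x y h hxy') fun h => hdisj' _ x y h hxy'

theorem ncard_edgeSet_map {V W : Type*} (f : V ↪ W) (G : SimpleGraph V) :
    (G.map f).edgeSet.ncard = G.edgeSet.ncard := by
  rw [SimpleGraph.edgeSet_map]
  exact Set.ncard_image_of_injective _ f.sym2Map.injective

theorem card_common_neighbors_ge {V : Type*} [Fintype V] (G : SimpleGraph V) {c : ℝ}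
    (hdeg : ∀ x, (Fintype.card V : ℝ) - c ≤ degIn G x univ) (Q : Finset V) :
    (Fintype.card V : ℝ) - Q.card * c ≤ (univ.filter fun v => ∀ q ∈ Q, G.Adj v q).card := by
  have h1 : (univ.filter fun v => ¬ ∀ q ∈ Q, G.Adj v q).card ≤
      ∑ q ∈ Q, (univ.filter fun v => ¬ G.Adj q v).card := by
    refine (Finset.card_le_card fun v hv => ?_).trans Finset.card_biUnion_le
    rw [Finset.mem_filter] at hv
    obtain ⟨-, hv⟩ := hv
    push Not at hv
    obtain ⟨q, hq, hvq⟩ := hv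
    rw [Finset.mem_biUnion]
    exact ⟨q, hq, Finset.mem_filter.2 ⟨Finset.mem_univ v, fun h => hvq h.symm⟩⟩
  have h2 : ∀ q ∈ Q, ((univ.filter fun v => ¬ G.Adj q v).card : ℝ) ≤ c := by
    intro q _
    have e : degIn G q univ + (univ.filter fun v => ¬ G.Adj q v).card = Fintype.card V :=
      Finset.card_filter_add_card_filter_not _
    have e' : (degIn G q univ : ℝ) + (univ.filter fun v => ¬ G.Adj q v).card =
        Fintype.card V := by exact_mod_cast e
    linarith [hdeg q]
  have h3 : ((univ.filter fun v => ¬ ∀ q ∈ Q, G.Adj v q).card : ℝ) ≤ Q.card * c := by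
    calc _ ≤ ((∑ q ∈ Q, (univ.filter fun v => ¬ G.Adj q v).card : ℕ) : ℝ) := by
          exact_mod_cast h1
      _ = ∑ q ∈ Q, ((univ.filter fun v => ¬ G.Adj q v).card : ℝ) := by push_cast; rfl
      _ ≤ _ := by
        rw [← nsmul_eq_mul]
        exact Finset.sum_le_card_nsmul _ _ _ h2
  have h4 : (univ.filter fun v => ∀ q ∈ Q, G.Adj v q).card +
      (univ.filter fun v => ¬ ∀ q ∈ Q, G.Adj v q).card = Fintype.card V :=
    Finset.card_filter_add_card_filter_not _
  have h5 : ((univ.filter fun v => ∀ q ∈ Q, G.Adj v q).card : ℝ) +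
      (univ.filter fun v => ¬ ∀ q ∈ Q, G.Adj v q).card = Fintype.card V := by exact_mod_cast h4
  linarith

end AbsorberFamily

/-! ### The decomposition threshold -/

section Decomposition

/-- Large divisible graphs with minimum degree somewhat above `max (3 / 4) δ` are decomposable if
`δ` has the approximate decomposition property: set aside absorbers for all possible leftovers on
the last set of a vortex, cover everything else outside that set, and absorb the leftover. -/
theorem ApproxDecompositionProperty.exists_hasTriangleDecomposition {δ ε : ℝ}
    (h : ApproxDecompositionProperty δ) (hδ : 3 / 4 ≤ δ) (hε : 0 < ε) :
    ∃ n₀ : ℕ, ∀ (V : Type*) [Fintype V] (G : SimpleGraph V), n₀ ≤ Fintype.card V →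
      (∀ x, Even (degIn G x univ)) → 3 ∣ G.edgeSet.ncard →
      (∀ x, (δ + 5 * ε) * Fintype.card V ≤ degIn G x univ) → HasTriangleDecomposition G := by
  obtain ⟨κ, hκ, hκ1, hvortex⟩ := exists_isVortex hε
  obtain ⟨m, hm⟩ := exists_cover_of_isVortex h hδ hε hκ hκ1
  obtain ⟨M, hM⟩ := hvortex m (δ + 4 * ε) (δ + 5 * ε) (by linarith)
  -- `T` bounds the number of vertices in the absorbers of all graphs on at most `M` vertices
  obtain ⟨T, hT⟩ : ∃ T : ℕ, T = ∑ k ∈ range (M + 1),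
      Nat.card (SimpleGraph (Fin k)) * Nat.card (AbsorberVertex (Fin k)) := ⟨_, rfl⟩
  refine ⟨M + ⌈(T + M + 1) / (ε * κ)⌉₊ + 1, fun V _ G hn heven hthree hdeg => ?_⟩
  obtain ⟨U, W, hUW, hW⟩ := hM V G (by omega) hdeg
  obtain ⟨x₀⟩ : Nonempty V := Fintype.card_pos_iff.1 (by omega)
  obtain ⟨n, hndef⟩ : ∃ n : ℝ, n = Fintype.card V := ⟨_, rfl⟩
  have hn0 : 0 < n := by rw [hndef]; exact_mod_cast (by omega : 0 < Fintype.card V)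
  have hTn : (T : ℝ) + M + 1 ≤ ε * κ * n := by
    rw [mul_comm, ← div_le_iff₀ (by positivity), hndef]
    exact (Nat.le_ceil _).trans
      (by exact_mod_cast (by omega : ⌈((T : ℝ) + M + 1) / (ε * κ)⌉₊ ≤ Fintype.card V))
  have hκn : ε * κ * n ≤ ε * n := by
    have := mul_le_mul_of_nonneg_left hκ1 (mul_pos hε hn0).le
    linarith
  have hWU : W ⊆ U := hUW.subset
  have hUn : (U.card : ℝ) ≤ ε * n := by
    have := hUW.step.card_upper
    rw [Finset.card_univ, ← hndef] at this
    exact this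
  -- index the last set of the vortex by `Fin k`
  obtain ⟨k, hk⟩ : ∃ k, k = W.card := ⟨_, rfl⟩
  obtain ⟨ι, hι⟩ : ∃ ι : Fin k ↪ V, ∀ x, x ∈ W ↔ ∃ r, ι r = x := by
    have e : Fin k ≃ W := (Fintype.equivFinOfCardEq (by rw [Fintype.card_coe, hk])).symm
    refine ⟨e.toEmbedding.trans (.subtype fun x => x ∈ W), fun x => ⟨fun hx => ?_, ?_⟩⟩
    · exact ⟨e.symm ⟨x, hx⟩, by simp⟩
    · rintro ⟨r, rfl⟩
      exact (e r).2
  let _ : Fintype (SimpleGraph (Fin k)) := Fintype.ofFinite _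
  set 𝓛 : Finset (SimpleGraph (Fin k)) :=
    univ.filter fun L => (∀ r, Even (degIn L r univ)) ∧ 3 ∣ L.edgeSet.ncard with h𝓛
  have h𝓛T : 𝓛.card * Nat.card (AbsorberVertex (Fin k)) ≤ T := by
    rw [hT]
    refine le_trans ?_ (Finset.single_le_sum (f := fun k => Nat.card (SimpleGraph (Fin k)) *
      Nat.card (AbsorberVertex (Fin k))) (fun _ _ => Nat.zero_le _)
      (Finset.mem_range.2 (by omega : k < M + 1)))
    refine Nat.mul_le_mul_right _ ?_
    rw [Nat.card_eq_fintype_card]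
    exact Finset.card_le_univ _
  obtain ⟨A, N, hAG, hN, hNU, hA, hAdec, hAL⟩ := exists_absorber_family ι G U
    (fun r => hWU ((hι _).2 ⟨r, rfl⟩)) 𝓛 (fun L hL => (Finset.mem_filter.1 hL).2) (by
      intro Q hQ
      have hc : 0 ≤ (1 / 4 - 5 * ε) * n := by
        have h1 := hdeg x₀
        have h2 : (degIn G x₀ univ : ℝ) ≤ Fintype.card V := by
          exact_mod_cast Finset.card_le_univ _
        rw [← hndef] at h1 h2
        have h3 := mul_le_mul_of_nonneg_right hδ hn0.le
        linarith
      have h1 := card_common_neighbors_ge G (c := (1 / 4 - 5 * ε) * n) (fun x => by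
        have h1 := hdeg x
        rw [← hndef] at h1 ⊢
        have h3 := mul_le_mul_of_nonneg_right hδ hn0.le
        linarith) Q
      have h2 : (Q.card : ℝ) * ((1 / 4 - 5 * ε) * n) ≤ 4 * ((1 / 4 - 5 * ε) * n) :=
        mul_le_mul_of_nonneg_right (by exact_mod_cast hQ) hc
      have h3 : ((𝓛.card * Nat.card (AbsorberVertex (Fin k)) : ℕ) : ℝ) ≤ T := by
        exact_mod_cast h𝓛T
      have h4 : (0 : ℝ) ≤ M := by positivity
      have h5 : 0 < ε * n := by positivity
      rw [← hndef] at h1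
      have h6 : ((U.card + 𝓛.card * Nat.card (AbsorberVertex (Fin k)) : ℕ) : ℝ) <
          (univ.filter fun v => ∀ q ∈ Q, G.Adj v q).card := by
        rw [Nat.cast_add]
        linarith
      exact_mod_cast h6)
  have hAsymm : ∀ x y, A.Adj x y → y ∈ N ∪ W := by
    intro x y hxy
    rcases (hA y x hxy.symm).2 with h | h
    · exact Finset.mem_union_left _ h
    · exact Finset.mem_union_right _ ((hι y).2 h)
  have hAdeg : ∀ x, (degIn A x univ : ℝ) ≤ T + M := by
    intro x
    have h1 : degIn A x univ ≤ (N ∪ W).card := degIn_le_card fun y _ hxy => hAsymm x y hxy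
    have h2 := Finset.card_union_le N W
    exact_mod_cast h1.trans (h2.trans (add_le_add (hN.trans h𝓛T) hW))
  -- cover the edges outside the last set
  obtain ⟨H, hH, hHdec, hcov⟩ := hm V G univ U W hUW (G \ A) sdiff_le
    (fun x y _ => ⟨Finset.mem_univ x, Finset.mem_univ y⟩)
    (fun x y hx hy hxy => ⟨hxy, fun hAxy =>
      (hA x y hAxy).1.elim (fun h => hNU x h hx) (fun h => hNU y h hy)⟩)
    (fun x _ => by
      rw [Finset.card_univ]
      refine le_trans ?_ (hdeg x)
      exact mul_le_mul_of_nonneg_right (by linarith) (by positivity))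
    (fun x _ => by
      rw [Finset.card_univ, ← hndef, sdiff_sdiff_right_self, inf_eq_right.2 hAG]
      linarith [hAdeg x])
    (fun x _ _ => by
      have h1 := heven x
      rw [← degIn_sdiff_add hAG x univ, Nat.even_add] at h1
      exact h1.2 (hAdec.divisible.1 x))
  -- the leftover is a divisible graph on the last set
  set F := (G \ A) \ H with hF
  have hFW : ∀ x y, F.Adj x y → x ∈ W ∧ y ∈ W := by
    intro x y hxy
    by_contra hcon
    exact hxy.2 (hcov x y hxy.1 hcon)
  have hFmap : (F.comap ι).map ι = F := by
    ext x y
    rw [SimpleGraph.map_adj]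
    constructor
    · rintro ⟨u, v, huv, rfl, rfl⟩
      exact huv
    · intro hxy
      obtain ⟨hx, hy⟩ := hFW x y hxy
      obtain ⟨u, rfl⟩ := (hι x).1 hx
      obtain ⟨v, rfl⟩ := (hι y).1 hy
      exact ⟨u, v, hxy, rfl, rfl⟩
  have hHF : ∀ x y, H.Adj x y → ¬ F.Adj x y := fun x y hxy hxy' => hxy'.2 hxy
  have hAGA : ∀ x y, A.Adj x y → ¬ (G \ A).Adj x y := fun x y hxy hxy' => hxy'.2 hxy
  have hsupF : H ⊔ F = G \ A := sup_sdiff_cancel_right hH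
  have hsupA : A ⊔ (G \ A) = G := sup_sdiff_cancel_right hAG
  have hL : F.comap ι ∈ 𝓛 := by
    refine Finset.mem_filter.2 ⟨Finset.mem_univ _, fun r => ?_, ?_⟩
    · have h1 : degIn (F.comap ι) r univ = degIn F (ι r) univ := by
        rw [degIn_comap_embedding, degIn_eq_univ]
        intro x y hxy
        rw [Finset.mem_map]
        obtain ⟨v, hv⟩ := (hι y).1 (hFW x y hxy).2
        exact ⟨v, Finset.mem_univ v, hv⟩
      have h2 := heven (ι r)
      rw [← hsupA, SimpleGraph.degIn_sup_of_disjoint hAGA, ← hsupF,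
        SimpleGraph.degIn_sup_of_disjoint hHF, Nat.even_add, Nat.even_add] at h2
      rw [h1]
      exact (h2.1 (hAdec.divisible.1 _)).1 (hHdec.divisible.1 _)
    · have h1 := ncard_edgeSet_sup_of_disjoint hAGA
      have h2 := ncard_edgeSet_sup_of_disjoint hHF
      rw [hsupA] at h1
      rw [hsupF] at h2
      have h3 := hAdec.divisible.2
      have h4 := hHdec.divisible.2
      rw [← ncard_edgeSet_map ι, hFmap]
      omega
  have hfinal := (hAL _ hL).sup hHdec (by
    rw [hFmap]
    rintro x y (hxy | hxy) hHxy
    · exact (hH hHxy).2 hxy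
    · exact hxy.2 hHxy)
  rw [hFmap, sup_assoc, sup_comm F H, hsupF, hsupA] at hfinal
  exact hfinal

/-- The property is vacuous at `1`: no nonempty graph has a vertex joined to all vertices, itself
included. -/
theorem approxDecompositionProperty_one : ApproxDecompositionProperty 1 := by
  intro γ _
  refine ⟨1, fun n hn G hG => absurd hG ?_⟩
  have : Nonempty (Fin n) := ⟨⟨0, hn⟩⟩
  obtain ⟨x, hx⟩ := G.exists_minimal_degree_vertex
  rw [one_mul, Nat.cast_le, hx, not_le]
  exact (G.degree_lt_card_verts x).trans_eq (Fintype.card_fin n)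

theorem approxDecompositionProperty_of_lt {δ : ℝ} (h : approxDecompositionThreshold < δ) :
    ApproxDecompositionProperty δ := by
  have hne : {δ : ℝ | δ ∈ Set.Icc (0 : ℝ) 1 ∧ ApproxDecompositionProperty δ}.Nonempty :=
    ⟨1, ⟨zero_le_one, le_rfl⟩, approxDecompositionProperty_one⟩
  obtain ⟨δ', ⟨-, h'⟩, hlt⟩ := exists_lt_of_csInf_lt hne h
  intro γ hγ
  obtain ⟨n₀, hn₀⟩ := h' γ hγ
  exact ⟨n₀, fun n hn G hG =>
    hn₀ n hn G ((mul_le_mul_of_nonneg_right hlt.le (Nat.cast_nonneg n)).trans hG)⟩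

theorem exists_hasTriangleDecomposition_of_le_minDegree {ε : ℝ} (hε : 0 < ε) :
    ∃ n₀ : ℕ, ∀ (V : Type*) [Fintype V] [DecidableEq V] (G : SimpleGraph V)
      [DecidableRel G.Adj], n₀ ≤ Fintype.card V → IsTriangleDivisible G →
      (max (3 / 4 : ℝ) approxDecompositionThreshold + ε) * (Fintype.card V : ℝ)
        ≤ (G.minDegree : ℝ) →
      HasTriangleDecomposition G := by
  set δ := max (3 / 4 : ℝ) approxDecompositionThreshold
  have h34 : 3 / 4 ≤ δ := le_max_left _ _
  have hthr : approxDecompositionThreshold ≤ δ := le_max_right _ _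
  have h1 : ApproxDecompositionProperty (δ + ε / 6) :=
    approxDecompositionProperty_of_lt (by linarith)
  obtain ⟨n₀, hn₀⟩ := h1.exists_hasTriangleDecomposition (ε := ε / 6)
    (by linarith) (by positivity)
  refine ⟨n₀, fun V _ _ G _ hn hdiv hdeg => hn₀ V G hn (fun x => ?_) ?_ fun x => ?_⟩
  · rw [← degree_eq_degIn]
    exact hdiv.2 x
  · rw [← SimpleGraph.coe_edgeFinset, Set.ncard_coe_finset]
    exact hdiv.1
  · rw [← degree_eq_degIn]
    refine le_trans (le_of_eq (by ring)) (hdeg.trans ?_)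
    exact_mod_cast G.minDegree_le_degree x

theorem decompositionThreshold_le :
    decompositionThreshold ≤ max (3 / 4 : ℝ) approxDecompositionThreshold := by
  refine le_of_forall_pos_le_add fun ε hε => ?_
  set δ := max (3 / 4 : ℝ) approxDecompositionThreshold
  have hδ : 0 ≤ δ := le_trans (by norm_num) (le_max_left _ _)
  obtain ⟨n₀, hn₀⟩ := exists_hasTriangleDecomposition_of_le_minDegree.{0} (half_pos hε)
  refine Filter.limsup_le_of_le ?_ ?_
  · exact (Filter.isBoundedUnder_of ⟨0, fun n => by positivity⟩).isCoboundedUnder_le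
  · rw [Filter.eventually_atTop]
    refine ⟨n₀ + ⌈2 / ε⌉₊ + 1, fun n hn => ?_⟩
    have hn0 : (0 : ℝ) < n := by exact_mod_cast (by omega : 0 < n)
    have h1 : minDegreeForDecomposition n ≤ ⌈(δ + ε / 2) * n⌉₊ := by
      refine Nat.sInf_le fun G hG hmin => hn₀ (Fin n) G (by rw [Fintype.card_fin]; omega) ?_ ?_
      · convert hG
      · rw [Fintype.card_fin]
        refine (Nat.le_ceil _).trans ?_
        convert (Nat.cast_le (α := ℝ)).2 hmin
    have h2 : (minDegreeForDecomposition n : ℝ) ≤ (δ + ε / 2) * n + 1 :=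
      ((Nat.cast_le (α := ℝ)).2 h1).trans (Nat.ceil_lt_add_one (by positivity)).le
    rw [div_le_iff₀ hn0]
    have h3 : 2 / ε ≤ n := (Nat.le_ceil _).trans (by exact_mod_cast (by omega : ⌈2 / ε⌉₊ ≤ n))
    rw [div_le_iff₀ hε] at h3
    linarith

end Decomposition

end

theorem theorem1p2 :
    (∀ ε : ℝ, 0 < ε → ∃ n₀ : ℕ, ∀ (V : Type*) [Fintype V] [DecidableEq V] (G : SimpleGraph V)
      [DecidableRel G.Adj], n₀ ≤ Fintype.card V → IsTriangleDivisible G →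
      (max (3 / 4 : ℝ) approxDecompositionThreshold + ε) * (Fintype.card V : ℝ)
        ≤ (G.minDegree : ℝ) →
      HasTriangleDecomposition G) ∧
    decompositionThreshold ≤ max (3 / 4 : ℝ) approxDecompositionThreshold := by
  exact ⟨fun _ hε => exists_hasTriangleDecomposition_of_le_minDegree hε, decompositionThreshold_le⟩
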